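/- Let $A\in\mathbb{R}^{n_z\times n_z}$, $B\in\mathbb{R}^{n_z\times n_s}$, $C\in\mathbb{R}^{n_y\times n_z}$, $S\in\mathbb{R}^{n_q\times n_z}$, $N\in\mathbb{R}^{n_z\times n_w}$, $C_p\in\mathbb{R}^{n_{y_p}\times n_z}$, let $\psi\colon\mathbb{R}^{n_q}\to\mathbb{R}^{n_s}$ be Lipschitz with constant $\ell>0$, and let $0<T_1\le T_2$. Given $L\in\mathbb{R}^{n_z\times n_y}$ and $H\in\mathbb{R}^{n_y\times n_y}$, put $\zeta(z,\varepsilon)=\psi(Sz)-\psi(S(z-\varepsilon))$ and $$\mathcal F=\begin{pmatrix}A-LC&L\\ CA-CLC-HC&CL+H\end{pmatrix},\quad \mathcal Q=\begin{pmatrix}B\\CB\end{pmatrix},\quad \mathcal T=\begin{pmatrix}N\\CN\end{pmatrix}.$$ Let $\mathcal H_e$ be the hybrid system with state $x=(z,\varepsilon,\tilde\theta,\tau)\in\mathbb{R}^{2n_z+n_y+1}$, input $u=(w,\eta)\in\mathbb{R}^{n_w}\times\mathbb{R}^{n_y}$ and output $y_p=C_p\varepsilon$, which flows for $\tau\in[0,T_2]$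 according to $$\dot z=Az+B\psi(Sz)+Nw,\quad (\dot\varepsilon,\dot{\tilde\theta})=\mathcal F(\varepsilon,\tilde\theta)+\mathcal Q\zeta(z,\varepsilon)+\mathcal Tw,\quad \dot\tau=-1,$$ and jumps for $\tau=0$ according to $z^+=z$, $\varepsilon^+=\varepsilon$, $\tilde\theta^+=-\eta$, $\tau^+\in[T_1,T_2]$. A solution pair $(\phi,u)$ consists of a hybrid arc $\phi$ (locally absolutely continuous along flows) and a hybrid input $u$ (Lebesgue measurable and, on bounded parts of its domain, essentially bounded along flows) on the same hybrid time domain, with $\phi(0,0)$ in the union of the flow set and the jump set, satisfying these dynamics; it is maximal if it cannot be extended, and complete if its domain is unbounded. Let $\mathcal A=\mathbb{R}^{n_z}\times\{0\}\times\{0\}\times[0,T_2]$, let $|x|_{\mathcal A}$ be the Euclidean distance of $x$ to $\mathcal A$, and let $\|u\|_\infty$ be the maximum of the essential supremum of $|u|$ away from the jump times and the supremum of $|u|$ over the jump times. Let $\lambda_t>0$. Suppose that $P_1\in\mathbb{R}^{n_z\times n_z}$ and $P_2\in\mathbb{R}^{n_y\times n_y}$ are symmetric positive definite, $\delta,\chi>0$,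 $L\in\mathbb{R}^{n_z\times n_y}$ and $H\in\mathbb{R}^{n_y\times n_y}$ are such that the symmetric matrix $$\begin{pmatrix} \operatorname{He}(P_1(A-LC))+2\lambda_tP_1+C_p^{\top}C_p+\chi\ell^2S^{\top}S & P_1L+e^{\delta\tau}(CA-CLC-HC)^{\top}P_2 & P_1B\\ \bullet & e^{\delta\tau}\bigl(\operatorname{He}(P_2(CL+H))+(2\lambda_t-\delta)P_2\bigr) & e^{\delta\tau}P_2CB\\ \bullet&\bullet&-\chi I_{n_s}\end{pmatrix},\qquad \operatorname{He}(X)=X+X^{\top},$$ is negative definite for $\tau=0$ and for $\tau=T_2$. Then there is $\gamma>0$ such that, for these $L$ and $H$: (i) $\mathcal H_e$ is exponentially input-to-state stable with respect to $\mathcal A$, that is, every maximal solution pair is complete, and there are $\kappa,\lambda>0$ and a class-$\mathcal K$ function $\rho$ such that every solution pair $(\phi,u)$ with $\|u\|_\infty<\infty$ satisfies $|\phi(t,j)|_{\mathcal A}\le\max\{\kappa e^{-\lambda(t+j)}|\phi(0,0)|_{\mathcal A},\ \rho(\|u\|_\infty)\}$ for all $(t,j)\in\operatorname{dom}\phi$;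 (ii) there is $\alpha>0$ such that every solution pair $(\phi,u)$ with $\eta\equiv0$ satisfies $$\sqrt{\int_{\mathcal I}|y_p(s,j(s))|^2\,ds}\le\alpha|\phi(0,0)|_{\mathcal A}+\gamma\sqrt{\int_{\mathcal I}|w(s,j(s))|^2\,ds},$$ where $\mathcal I=\{s:(s,j)\in\operatorname{dom}\phi\text{ for some }j\}$ and $j(s)=\min\{j:(s,j)\in\operatorname{dom}\phi\}$ (the right-hand side may be infinite). -/

import Mathlib

open MeasureTheory Set
open scoped ENNReal Matrix

noncomputable section

namespace SporadicObs

/-! ### Euclidean vectors indexed by (sums of) finite types -/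

/-- `ℝ^ι` with the Euclidean norm. -/
abbrev Vec (ι : Type) : Type := EuclideanSpace ℝ ι

/-- The first component of a stacked vector `(a, b)`. -/
def Vec.first {ι κ : Type} (v : Vec (ι ⊕ κ)) : Vec ι :=
  WithLp.toLp 2 (fun i => v (Sum.inl i))

/-- The second component of a stacked vector `(a, b)`. -/
def Vec.second {ι κ : Type} (v : Vec (ι ⊕ κ)) : Vec κ :=
  WithLp.toLp 2 (fun i => v (Sum.inr i))

/-- The stacked vector `(a, b)`. -/
def Vec.stack {ι κ : Type} (a : Vec ι) (b : Vec κ) : Vec (ι ⊕ κ) :=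
  WithLp.toLp 2 (Sum.elim (fun i => a i) (fun i => b i))

/-- Matrix times Euclidean vector. -/
def mulV {ι κ : Type} [Fintype κ] (M : Matrix ι κ ℝ) (v : Vec κ) : Vec ι :=
  WithLp.toLp 2 (M *ᵥ (fun i => v i))

/-! ### Hybrid time domains, hybrid signals -/

/-- `E` is the union of finitely or infinitely many intervals `[t_j, t_{j+1}] × {j}`, where
`0 = t_0 ≤ t_1 ≤ …`; if there is a last interval, it may be of the form `[t_j, T)` with
`T` finite or infinite. -/
def IsHybridTimeDomain (E : Set (ℝ × ℕ)) : Prop :=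
  ∃ t : ℕ → ℝ, t 0 = 0 ∧ Monotone t ∧
    (E = {p | p.1 ∈ Icc (t p.2) (t (p.2 + 1))} ∨
      ∃ (J : ℕ) (last : Set ℝ),
        (last = Icc (t J) (t (J + 1)) ∨ (t J < t (J + 1) ∧ last = Ico (t J) (t (J + 1))) ∨
          last = Ici (t J)) ∧
        E = {p | (p.2 < J ∧ p.1 ∈ Icc (t p.2) (t (p.2 + 1))) ∨ (p.2 = J ∧ p.1 ∈ last)})

/-- A hybrid signal: a function on a hybrid time domain. The values of `val` off `dom` play no
role. -/
structure HybridSignal (V : Type) where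
  dom : Set (ℝ × ℕ)
  isDomain : IsHybridTimeDomain dom
  val : ℝ → ℕ → V

namespace HybridSignal

/-- The interval of ordinary times `t` with `(t, j) ∈ dom`. -/
def slice {V : Type} (φ : HybridSignal V) (j : ℕ) : Set ℝ := {t | (t, j) ∈ φ.dom}

/-- The projection of the domain to ordinary time. -/
def domT {V : Type} (φ : HybridSignal V) : Set ℝ := {t | ∃ j, (t, j) ∈ φ.dom}

/-- `j(t) = min {j | (t, j) ∈ dom}`. -/
def firstIdx {V : Type} (φ : HybridSignal V) (t : ℝ) : ℕ := sInf {j | (t, j) ∈ φ.dom}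

/-- The jump times: `(t, j) ∈ dom` such that `(t, j + 1) ∈ dom`. -/
def jumpSet {V : Type} (φ : HybridSignal V) : Set (ℝ × ℕ) :=
  {p | p ∈ φ.dom ∧ (p.1, p.2 + 1) ∈ φ.dom}

/-- Unbounded domain (domains lie in `[0, ∞) × ℕ`). -/
def IsComplete {V : Type} (φ : HybridSignal V) : Prop :=
  ∀ R : ℝ, ∃ p ∈ φ.dom, R ≤ p.1 + p.2

/-- `φ'` extends `φ`, possibly trivially. -/
def Extends {V : Type} (φ' φ : HybridSignal V) : Prop :=
  φ.dom ⊆ φ'.dom ∧ ∀ t j, (t, j) ∈ φ.dom → φ'.val t j = φ.val t j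

/-- Hybrid input: every `u(·, j)` is Lebesgue measurable and locally essentially bounded, that is,
essentially bounded on every bounded part of its domain. -/
def IsHybridInput {ι : Type} [Fintype ι] (u : HybridSignal (Vec ι)) : Prop :=
  ∀ j, AEMeasurable (fun t => u.val t j) (volume.restrict (u.slice j)) ∧
    ∀ R : ℝ, ∃ M : ℝ, ∀ᵐ t ∂(volume.restrict (u.slice j ∩ Iic R)), ‖u.val t j‖ ≤ M

/-- Hybrid arc: every `φ(·, j)` is locally absolutely continuous. -/
def IsHybridArc {ι : Type} [Fintype ι] (φ : HybridSignal (Vec ι)) : Prop :=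
  ∀ j, ∀ a b : ℝ, a ≤ b → Icc a b ⊆ φ.slice j →
    AbsolutelyContinuousOnInterval (fun t => φ.val t j) a b

/-- The `T`-truncated `L_∞` norm (with values in `[0, ∞]`): the maximum of the essential supremum
away from the jump times and of the supremum over the jump times. -/
def linftyTrunc {ι : Type} [Fintype ι] (u : HybridSignal (Vec ι)) (T : ℝ) : ℝ≥0∞ :=
  max
    (⨆ k : ℕ, essSup (fun s => ‖u.val s k‖ₑ)
      (volume.restrict {s | (s, k) ∈ u.dom \ u.jumpSet ∧ s + k ≤ T}))
    (⨆ p ∈ {p : ℝ × ℕ | p ∈ u.jumpSet ∧ p.1 + p.2 ≤ T}, ‖u.val p.1 p.2‖ₑ)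

/-- The `L_∞` norm: the limit, that is, the supremum, of the truncated norms, which are
nondecreasing in `T`. -/
def linfty {ι : Type} [Fintype ι] (u : HybridSignal (Vec ι)) : ℝ≥0∞ :=
  ⨆ T : ℝ, u.linftyTrunc T

end HybridSignal

/-! ### Hybrid systems with inputs -/

/-- Data of a hybrid system with state in `ℝ^ι`, flow input `w ∈ ℝ^κ` and jump input `η ∈ ℝ^μ`:
`ẋ = f(x, w)` for `x ∈ C`, `x⁺ ∈ G(x, η)` for `x ∈ D`. -/
structure HybridSystem (ι κ μ : Type) where
  flowSet : Set (Vec ι)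
  flowMap : Vec ι → Vec κ → Vec ι
  jumpSet : Set (Vec ι)
  jumpMap : Vec ι → Vec μ → Set (Vec ι)

namespace HybridSystem

variable {ι κ μ : Type} [Fintype ι] [Fintype κ] [Fintype μ]

/-- `(φ, u)` with `u = (w, η)` is a solution pair. -/
structure IsSolutionPair (S : HybridSystem ι κ μ) (φ : HybridSignal (Vec ι))
    (u : HybridSignal (Vec (κ ⊕ μ))) : Prop where
  arc : φ.IsHybridArc
  input : u.IsHybridInput
  dom_eq : φ.dom = u.dom
  init : φ.val 0 0 ∈ closure S.flowSet ∪ S.jumpSet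
  flow_mem : ∀ j, ∀ t ∈ interior (φ.slice j), φ.val t j ∈ S.flowSet
  flow_deriv : ∀ j, ∀ᵐ t ∂(volume.restrict (φ.slice j)),
    HasDerivAt (fun s => φ.val s j) (S.flowMap (φ.val t j) (u.val t j).first) t
  jump : ∀ p ∈ φ.jumpSet, φ.val p.1 p.2 ∈ S.jumpSet ∧
    φ.val p.1 (p.2 + 1) ∈ S.jumpMap (φ.val p.1 p.2) (u.val p.1 p.2).second

/-- A solution pair that cannot be extended. -/
def IsMaximalPair (S : HybridSystem ι κ μ) (φ : HybridSignal (Vec ι))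
    (u : HybridSignal (Vec (κ ⊕ μ))) : Prop :=
  S.IsSolutionPair φ u ∧
    ∀ φ' u', S.IsSolutionPair φ' u' → φ'.Extends φ → u'.Extends u → φ'.dom = φ.dom

end HybridSystem

/-- Class `K`: continuous, strictly increasing on `[0, ∞)`, zero at zero. -/
def IsClassK (ρ : ℝ → ℝ) : Prop :=
  ContinuousOn ρ (Ici 0) ∧ StrictMonoOn ρ (Ici 0) ∧ ρ 0 = 0

namespace HybridSystem

variable {ι κ μ : Type} [Fintype ι] [Fintype κ] [Fintype μ]

/-- Pre-exponential input-to-state stability with respect to `A`. -/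
def IsPreEISS (S : HybridSystem ι κ μ) (A : Set (Vec ι)) : Prop :=
  ∃ k > (0 : ℝ), ∃ lam > (0 : ℝ), ∃ ρ : ℝ → ℝ, IsClassK ρ ∧
    ∀ φ u, S.IsSolutionPair φ u → u.linfty < ⊤ →
      ∀ t j, (t, j) ∈ φ.dom →
        Metric.infDist (φ.val t j) A ≤
          max (k * Real.exp (-lam * (t + j)) * Metric.infDist (φ.val 0 0) A)
            (ρ u.linfty.toReal)

/-- Exponential input-to-state stability (eISS) with respect to `A`: pre-exponential
input-to-state stability, and every maximal solution pair is complete. -/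
def IsEISS (S : HybridSystem ι κ μ) (A : Set (Vec ι)) : Prop :=
  S.IsPreEISS A ∧ ∀ φ u, S.IsMaximalPair φ u → φ.IsComplete

end HybridSystem

/-! ### Plant, observer error dynamics -/

/-- Data of the plant `ż = A z + B ψ(S z) + N w`, `y = C z + η`, with performance output
`y_p = C_p (z - ẑ)`. -/
structure Plant (nz ny nw nq ns np : ℕ) where
  A : Matrix (Fin nz) (Fin nz) ℝ
  B : Matrix (Fin nz) (Fin ns) ℝ
  C : Matrix (Fin ny) (Fin nz) ℝ
  S : Matrix (Fin nq) (Fin nz) ℝ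
  N : Matrix (Fin nz) (Fin nw) ℝ
  Cp : Matrix (Fin np) (Fin nz) ℝ
  ψ : Vec (Fin nq) → Vec (Fin ns)

/-- Index type of the state `x = (z, (ε, θ̃), τ) ∈ ℝ^(2 n_z + n_y + 1)`. -/
abbrev StateIdx (nz ny : ℕ) : Type := Fin nz ⊕ ((Fin nz ⊕ Fin ny) ⊕ Fin 1)

section State

variable {nz ny : ℕ}

/-- The plant state `z`. -/
def zPart (x : Vec (StateIdx nz ny)) : Vec (Fin nz) := x.first

/-- The pair `(ε, θ̃)`. -/
def errPart (x : Vec (StateIdx nz ny)) : Vec (Fin nz ⊕ Fin ny) := x.second.first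

/-- The timer `τ`. -/
def timer (x : Vec (StateIdx nz ny)) : ℝ := x.second.second 0

/-- The state `(z, (ε, θ̃), τ)`. -/
def mkState (z : Vec (Fin nz)) (e : Vec (Fin nz ⊕ Fin ny)) (τ : ℝ) : Vec (StateIdx nz ny) :=
  Vec.stack z (Vec.stack e (WithLp.toLp 2 fun _ => τ))

end State

namespace Plant

variable {nz ny nw nq ns np : ℕ} (P : Plant nz ny nw nq ns np)

/-- `ζ(v₁, v₂) = ψ(S v₁) - ψ(S (v₁ - v₂))`. -/
def zeta (v₁ v₂ : Vec (Fin nz)) : Vec (Fin ns) :=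
  P.ψ (mulV P.S v₁) - P.ψ (mulV P.S (v₁ - v₂))

/-- The matrix `𝓕`. -/
def calF (L : Matrix (Fin nz) (Fin ny) ℝ) (H : Matrix (Fin ny) (Fin ny) ℝ) :
    Matrix (Fin nz ⊕ Fin ny) (Fin nz ⊕ Fin ny) ℝ :=
  Matrix.fromBlocks (P.A - L * P.C) L
    (P.C * P.A - P.C * L * P.C - H * P.C) (P.C * L + H)

/-- The matrix `𝓣`. -/
def calT : Matrix (Fin nz ⊕ Fin ny) (Fin nw) ℝ := Matrix.fromRows P.N (P.C * P.N)

/-- The matrix `𝓠`. -/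
def calQ : Matrix (Fin nz ⊕ Fin ny) (Fin ns) ℝ := Matrix.fromRows P.B (P.C * P.B)

/-- The matrix `𝓖`. -/
def calG (nz ny : ℕ) : Matrix (Fin nz ⊕ Fin ny) (Fin nz ⊕ Fin ny) ℝ :=
  Matrix.fromBlocks 1 0 0 0

/-- The matrix `𝓝`. -/
def calN (nz ny : ℕ) : Matrix (Fin nz ⊕ Fin ny) (Fin ny) ℝ := Matrix.fromRows 0 (-1)

/-- The hybrid system `𝓗_e` of plant, estimation error and timer. -/
def errorSystem (L : Matrix (Fin nz) (Fin ny) ℝ) (H : Matrix (Fin ny) (Fin ny) ℝ) (T₁ T₂ : ℝ) :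
    HybridSystem (StateIdx nz ny) (Fin nw) (Fin ny) where
  flowSet := {x | timer x ∈ Icc 0 T₂}
  flowMap := fun x w =>
    mkState
      (mulV P.A (zPart x) + mulV P.B (P.ψ (mulV P.S (zPart x))) + mulV P.N w)
      (mulV (P.calF L H) (errPart x) + mulV P.calQ (P.zeta (zPart x) (errPart x).first)
        + mulV P.calT w)
      (-1)
  jumpSet := {x | timer x = 0}
  jumpMap := fun x η =>
    {g | ∃ v ∈ Icc T₁ T₂,
      g = mkState (zPart x) (mulV (calG nz ny) (errPart x) + mulV (calN nz ny) η) v}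

/-- The set `ℝ^{n_z} × {0} × {0} × [0, T₂]`. -/
def attractor (nz ny : ℕ) (T₂ : ℝ) : Set (Vec (StateIdx nz ny)) :=
  {x | errPart x = 0 ∧ timer x ∈ Icc 0 T₂}

/-- The performance output `y_p = C_p ε`. -/
def perfOutput (x : Vec (StateIdx nz ny)) : Vec (Fin np) := mulV P.Cp (errPart x).first

/-- The bound on the `L₂` gain from `w` to `y_p` by `γ`: there is `α > 0` such that every solution
pair with `η ≡ 0` satisfies `‖y_p‖₂ ≤ α |φ(0,0)|_𝓐 + γ ‖w‖₂`, the `L₂` norms (with values in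
`[0, ∞]`) being taken over the ordinary times in the domain of the solution. -/
def HasL2Gain (L : Matrix (Fin nz) (Fin ny) ℝ) (H : Matrix (Fin ny) (Fin ny) ℝ) (T₁ T₂ γ : ℝ) :
    Prop :=
  ∃ α > (0 : ℝ), ∀ φ u, (P.errorSystem L H T₁ T₂).IsSolutionPair φ u →
    (∀ t j, (t, j) ∈ u.dom → (u.val t j).second = 0) →
    (∫⁻ s in φ.domT, ‖P.perfOutput (φ.val s (φ.firstIdx s))‖ₑ ^ 2) ^ (1 / 2 : ℝ) ≤
      ENNReal.ofReal (α * Metric.infDist (φ.val 0 0) (attractor nz ny T₂)) +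
        ENNReal.ofReal γ *
          (∫⁻ s in u.domT, ‖(u.val s (u.firstIdx s)).first‖ₑ ^ 2) ^ (1 / 2 : ℝ)

/-! ### The matrix inequality -/

/-- `He(M) = M + Mᵀ`. -/
def He {n : ℕ} (M : Matrix (Fin n) (Fin n) ℝ) : Matrix (Fin n) (Fin n) ℝ := M + Mᵀ

/-- The symmetric matrix `𝓜(τ)`, with blocks indexed by `(ε, θ̃, w, ζ)`. -/
def calM (lamt ell γ : ℝ) (P₁ : Matrix (Fin nz) (Fin nz) ℝ) (P₂ : Matrix (Fin ny) (Fin ny) ℝ)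
    (δ χ : ℝ) (L : Matrix (Fin nz) (Fin ny) ℝ) (H : Matrix (Fin ny) (Fin ny) ℝ) (τ : ℝ) :
    Matrix (Fin nz ⊕ (Fin ny ⊕ (Fin nw ⊕ Fin ns))) (Fin nz ⊕ (Fin ny ⊕ (Fin nw ⊕ Fin ns))) ℝ :=
  let M₁₁ : Matrix (Fin nz) (Fin nz) ℝ :=
    He (P₁ * (P.A - L * P.C)) + (2 * lamt) • P₁ + P.Cpᵀ * P.Cp + (χ * ell ^ 2) • (P.Sᵀ * P.S)
  let M₁₂ : Matrix (Fin nz) (Fin ny) ℝ :=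
    P₁ * L + Real.exp (δ * τ) • ((P.C * P.A - P.C * L * P.C - H * P.C)ᵀ * P₂)
  let M₁₃ : Matrix (Fin nz) (Fin nw) ℝ := P₁ * P.N
  let M₁₄ : Matrix (Fin nz) (Fin ns) ℝ := P₁ * P.B
  let M₂₂ : Matrix (Fin ny) (Fin ny) ℝ :=
    Real.exp (δ * τ) • (He (P₂ * (P.C * L + H)) + (2 * lamt - δ) • P₂)
  let M₂₃ : Matrix (Fin ny) (Fin nw) ℝ := Real.exp (δ * τ) • (P₂ * P.C * P.N)
  let M₂₄ : Matrix (Fin ny) (Fin ns) ℝ := Real.exp (δ * τ) • (P₂ * P.C * P.B)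
  let M₃₃ : Matrix (Fin nw) (Fin nw) ℝ := (-γ ^ 2) • (1 : Matrix (Fin nw) (Fin nw) ℝ)
  let M₄₄ : Matrix (Fin ns) (Fin ns) ℝ := (-χ) • (1 : Matrix (Fin ns) (Fin ns) ℝ)
  Matrix.fromBlocks
    M₁₁ (Matrix.fromCols M₁₂ (Matrix.fromCols M₁₃ M₁₄))
    (Matrix.fromRows M₁₂ᵀ (Matrix.fromRows M₁₃ᵀ M₁₄ᵀ))
    (Matrix.fromBlocks
      M₂₂ (Matrix.fromCols M₂₃ M₂₄)
      (Matrix.fromRows M₂₃ᵀ M₂₄ᵀ)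
      (Matrix.fromBlocks M₃₃ 0 0 M₄₄))

/-- The inclusion of the indices `(ε, θ̃, ζ)` into `(ε, θ̃, w, ζ)`. -/
def keepIdx (nz ny nw ns : ℕ) :
    Fin nz ⊕ (Fin ny ⊕ Fin ns) → Fin nz ⊕ (Fin ny ⊕ (Fin nw ⊕ Fin ns)) :=
  Sum.map id (Sum.map id Sum.inr)

/-- `𝓜(τ)` with the row and the column of blocks of `w` removed. It does not depend on `γ`, as
`calM_submatrix` shows, so `γ` is set to `0` here. -/
def calMred (lamt ell : ℝ) (P₁ : Matrix (Fin nz) (Fin nz) ℝ) (P₂ : Matrix (Fin ny) (Fin ny) ℝ)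
    (δ χ : ℝ) (L : Matrix (Fin nz) (Fin ny) ℝ) (H : Matrix (Fin ny) (Fin ny) ℝ) (τ : ℝ) :
    Matrix (Fin nz ⊕ (Fin ny ⊕ Fin ns)) (Fin nz ⊕ (Fin ny ⊕ Fin ns)) ℝ :=
  (P.calM lamt ell 0 P₁ P₂ δ χ L H τ).submatrix (keepIdx nz ny nw ns) (keepIdx nz ny nw ns)

theorem calM_submatrix (lamt ell γ : ℝ) (P₁ : Matrix (Fin nz) (Fin nz) ℝ)
    (P₂ : Matrix (Fin ny) (Fin ny) ℝ) (δ χ : ℝ) (L : Matrix (Fin nz) (Fin ny) ℝ)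
    (H : Matrix (Fin ny) (Fin ny) ℝ) (τ : ℝ) :
    (P.calM lamt ell γ P₁ P₂ δ χ L H τ).submatrix (keepIdx nz ny nw ns) (keepIdx nz ny nw ns)
      = P.calMred lamt ell P₁ P₂ δ χ L H τ := by
  ext i j
  rcases i with i | i | i <;> rcases j with j | j | j <;> rfl

end Plant

end SporadicObs

end

namespace SporadicObs

/-! ### Absolutely continuous functions -/

section AbsolutelyContinuous

open AbsolutelyContinuousOnInterval

/-! The proof rests on the storage function `V = εᵀP₁ε + e^{δτ} θ̃ᵀP₂θ̃`. On states with timer in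
`[0, T₂]` it is comparable to `|x|_𝓐² = ‖(ε, θ̃)‖²` (`exists_storage_bounds`, `infDist_attractor`).
As `τ̇ = -1`, the weight `e^{δτ}` contributes `-δ e^{δτ} θ̃ᵀP₂θ̃` along flows.

The quadratic form of the given matrix is affine in `e^{δτ}`, so negativity at `τ = 0` and `τ = T₂`
gives a uniform margin `m` in between (`exists_form_le`). The Lipschitz bound makes `χ(ℓ²‖Sε‖² -
‖ζ‖²)` nonnegative, so this term may be dropped. The matrix has no row for `w`: the cross terms with
`w` are absorbed by the margin through Young's inequality, and this is where `γ` comes from. The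
result is `V̇ ≤ -2λ_t V - ‖y_p‖² + γ²‖w‖²` (`exists_storageDeriv_le`). A jump keeps `ε` and replaces
`θ̃` by `-η`, so it raises `V` by at most a multiple of `‖η‖²` (`storage_jump_le`).

Stability: between jumps `V` decays up to an offset. From the first jump on, consecutive jumps are
at least `T₁` apart, so the contributions of the jumps are dominated by a geometric series
(`storage_start_le`). The same spacing gives `T₁ j ≤ t + T₁`, which turns decay in `t` into decay in
`t + j`.

Gain: for `η = 0` jumps do not increase `V`, so the integrated inequality telescopes over the flow
intervals.

Completeness: the flow map is globally Lipschitz, which excludes finite escape. At a closed right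
end either the timer is zero and a jump is possible, or it is positive and the flow continues. -/

theorem absolutelyContinuousOnInterval_comp_lipschitzOnWith {X Y : Type*} [PseudoMetricSpace X]
    [PseudoMetricSpace Y] {f : ℝ → X} {g : X → Y} {a b : ℝ} {K : NNReal} {s : Set X}
    (hg : LipschitzOnWith K g s) (hs : MapsTo f (uIcc a b) s)
    (hf : AbsolutelyContinuousOnInterval f a b) :
    AbsolutelyContinuousOnInterval (fun t => g (f t)) a b := by
  rw [absolutelyContinuousOnInterval_iff] at hf ⊢
  intro ε hε
  obtain ⟨d, hd, h⟩ := hf (ε / (K + 1)) (by positivity)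
  refine ⟨d, hd, fun E hE hl => ?_⟩
  have h1 := h E hE hl
  calc ∑ i ∈ Finset.range E.1, dist (g (f (E.2 i).1)) (g (f (E.2 i).2))
      ≤ ∑ i ∈ Finset.range E.1, K * dist (f (E.2 i).1) (f (E.2 i).2) :=
        Finset.sum_le_sum fun i hi =>
          hg.dist_le_mul _ (hs (hE.1 i hi).1) _ (hs (hE.1 i hi).2)
    _ = K * ∑ i ∈ Finset.range E.1, dist (f (E.2 i).1) (f (E.2 i).2) := by
        rw [Finset.mul_sum]
    _ ≤ K * (ε / (K + 1)) := by gcongr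
    _ < ε := by
        rw [mul_div_assoc', div_lt_iff₀ (by positivity)]
        nlinarith [K.coe_nonneg]

theorem absolutelyContinuousOnInterval_comp_contDiff {E F : Type*} [NormedAddCommGroup E]
    [NormedSpace ℝ E] [FiniteDimensional ℝ E] [NormedAddCommGroup F] [NormedSpace ℝ F]
    {f : ℝ → E} {g : E → F} {a b : ℝ} (hg : ContDiff ℝ 1 g)
    (hf : AbsolutelyContinuousOnInterval f a b) :
    AbsolutelyContinuousOnInterval (fun t => g (f t)) a b := by
  obtain ⟨R, hR⟩ := hf.exists_bound
  obtain ⟨K, hK⟩ := hg.contDiffOn.exists_lipschitzOnWith (by decide)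
    (convex_closedBall (0 : E) R) (isCompact_closedBall (0 : E) R)
  exact absolutelyContinuousOnInterval_comp_lipschitzOnWith hK
    (fun t ht => by simpa using hR t ht) hf

/-- Shrinking the intervals of a disjoint family keeps it disjoint and does not increase its total
length. The intended `p` are the truncations `min · b` and `max · b`. -/
theorem absolutelyContinuousOnInterval_reparam {X : Type*} [PseudoMetricSpace X] {f : ℝ → X}
    {p : ℝ → ℝ} {a b c d : ℝ} (hp : MapsTo p (uIcc a b) (uIcc c d))
    (hd : ∀ x y, dist (p x) (p y) ≤ dist x y) (hI : ∀ x y, uIoc (p x) (p y) ⊆ uIoc x y)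
    (hf : AbsolutelyContinuousOnInterval f c d) :
    AbsolutelyContinuousOnInterval (fun t => f (p t)) a b := by
  rw [absolutelyContinuousOnInterval_iff] at hf ⊢
  intro ε hε
  obtain ⟨η, hη, h⟩ := hf ε hε
  refine ⟨η, hη, fun E hE hl => ?_⟩
  refine h (E.1, fun i => (p (E.2 i).1, p (E.2 i).2)) ⟨?_, ?_⟩ ?_
  · exact fun i hi => ⟨hp (hE.1 i hi).1, hp (hE.1 i hi).2⟩
  · exact fun i hi j hj hij => (hE.2 hi hj hij).mono (hI _ _) (hI _ _)
  · exact (Finset.sum_le_sum fun i _ => hd _ _).trans_lt hl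

/-- Truncation of the argument gives `f t = f (min t b) + f (max t b) - f b`, and each summand is
absolutely continuous on the whole interval. -/
theorem absolutelyContinuousOnInterval_glue {E : Type*} [NormedAddCommGroup E]
    {f : ℝ → E} {a b c : ℝ} (hab : a ≤ b) (hbc : b ≤ c)
    (h₁ : AbsolutelyContinuousOnInterval f a b) (h₂ : AbsolutelyContinuousOnInterval f b c) :
    AbsolutelyContinuousOnInterval f a c := by
  have k₁ : AbsolutelyContinuousOnInterval (fun t => f (min t b)) a c := by
    refine absolutelyContinuousOnInterval_reparam ?_ ?_ ?_ h₁
    · intro x hx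
      rw [uIcc_of_le (hab.trans hbc)] at hx
      rw [uIcc_of_le hab]
      exact ⟨le_min hx.1 hab, min_le_right _ _⟩
    · intro x y
      simp only [Real.dist_eq]
      exact (abs_min_sub_min_le_max x b y b).trans (by simp)
    · intro x y z
      simp only [mem_uIoc]
      grind
  have k₂ : AbsolutelyContinuousOnInterval (fun t => f (max t b)) a c := by
    refine absolutelyContinuousOnInterval_reparam ?_ ?_ ?_ h₂
    · intro x hx
      rw [uIcc_of_le (hab.trans hbc)] at hx
      rw [uIcc_of_le hbc]
      exact ⟨le_max_right _ _, max_le hx.2 hbc⟩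
    · intro x y
      simp only [Real.dist_eq]
      exact (abs_max_sub_max_le_max x b y b).trans (by simp)
    · intro x y z
      simp only [mem_uIoc]
      grind
  have k₃ : AbsolutelyContinuousOnInterval (fun _ : ℝ => f b) a c :=
    (LipschitzWith.const (f b)).lipschitzOnWith.absolutelyContinuousOnInterval
  have := (k₁.fun_add k₂).fun_sub k₃
  convert this using 2 with t
  rcases le_total t b with h | h <;> simp [h]

theorem absolutelyContinuousOnInterval_congr {X : Type*} [PseudoMetricSpace X]
    {f g : ℝ → X} {a b : ℝ} (hf : AbsolutelyContinuousOnInterval f a b)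
    (h : EqOn f g (uIcc a b)) : AbsolutelyContinuousOnInterval g a b := by
  rw [absolutelyContinuousOnInterval_iff] at hf ⊢
  intro ε hε
  obtain ⟨η, hη, k⟩ := hf ε hε
  refine ⟨η, hη, fun E hE hl => ?_⟩
  refine lt_of_eq_of_lt (Finset.sum_congr rfl fun i hi => ?_) (k E hE hl)
  rw [h (hE.1 i hi).1, h (hE.1 i hi).2]

/-- Increments of an absolutely continuous function are bounded by the integral of an upper bound
of its derivative. -/
theorem sub_le_integral_of_ae_hasDerivAt_le {f f' h : ℝ → ℝ} {a b : ℝ} (hab : a ≤ b)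
    (hf : AbsolutelyContinuousOnInterval f a b)
    (hd : ∀ᵐ t ∂(volume.restrict (Icc a b)), HasDerivAt f (f' t) t ∧ f' t ≤ h t)
    (hh : IntegrableOn h (Icc a b)) : f b - f a ≤ ∫ t in Icc a b, h t := by
  rw [← hf.integral_deriv_eq_sub, intervalIntegral.integral_of_le hab, ← integral_Icc_eq_integral_Ioc]
  refine integral_mono_ae ?_ hh ?_
  · have := hf.intervalIntegrable_deriv
    rwa [intervalIntegrable_iff_integrableOn_Icc_of_le hab] at this
  · filter_upwards [hd] with t ht
    rw [ht.1.deriv]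
    exact ht.2

theorem le_of_ae_hasDerivAt_nonpos {f f' : ℝ → ℝ} {a b : ℝ} (hab : a ≤ b)
    (hf : AbsolutelyContinuousOnInterval f a b)
    (hd : ∀ᵐ t ∂(volume.restrict (Icc a b)), HasDerivAt f (f' t) t ∧ f' t ≤ 0) : f b ≤ f a := by
  have := sub_le_integral_of_ae_hasDerivAt_le hab hf hd (h := fun _ => 0) (by simp)
  simp only [integral_zero] at this
  linarith

/-- An absolutely continuous function with a.e. constant derivative is affine. -/
theorem eq_add_mul_of_ae_hasDerivAt_const {f : ℝ → ℝ} {a b c : ℝ} (hab : a ≤ b)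
    (hf : AbsolutelyContinuousOnInterval f a b)
    (hd : ∀ᵐ t ∂(volume.restrict (Icc a b)), HasDerivAt f c t) : f b = f a + c * (b - a) := by
  have h₁ := sub_le_integral_of_ae_hasDerivAt_le (h := fun _ => c) hab hf
    (hd.mono fun t ht => ⟨ht, le_rfl⟩) (by simp)
  have h₂ := sub_le_integral_of_ae_hasDerivAt_le (h := fun _ => -c) hab hf.fun_neg
    (hd.mono fun t ht => ⟨ht.neg, le_rfl⟩) (by simp)
  simp only [setIntegral_const, Real.volume_real_Icc_of_le hab, smul_eq_mul] at h₁ h₂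
  nlinarith

/-- A function with a.e. bounded derivative that is absolutely continuous on compact intervals is
Lipschitz. -/
theorem dist_le_of_ae_hasDerivAt_norm_le {ι : Type} [Fintype ι] {f f' : ℝ → Vec ι} {a b D : ℝ}
    (hab : a ≤ b) (hf : AbsolutelyContinuousOnInterval f a b)
    (hd : ∀ᵐ t ∂(volume.restrict (Icc a b)), HasDerivAt f (f' t) t ∧ ‖f' t‖ ≤ D) :
    ‖f b - f a‖ ≤ D * (b - a) := by
  -- Pairing with `v` reduces to the scalar case: `‖v‖² = ∫ ⟨v, f'⟩ ≤ ‖v‖ D (b - a)`.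
  set v := f b - f a with hv
  have hL : ContDiff ℝ 1 (fun x : Vec ι => inner ℝ v x) := (innerSL ℝ v).contDiff
  have h₁ := sub_le_integral_of_ae_hasDerivAt_le (h := fun _ => ‖v‖ * D)
    (f' := fun t => inner ℝ v (f' t)) hab (absolutelyContinuousOnInterval_comp_contDiff hL hf)
    (hd.mono fun t ht => ⟨((innerSL ℝ v).hasFDerivAt.comp_hasDerivAt t ht.1),
      (real_inner_le_norm _ _).trans (mul_le_mul_of_nonneg_left ht.2 (norm_nonneg v))⟩)
    continuous_const.integrableOn_Icc
  simp only [setIntegral_const, Real.volume_real_Icc_of_le hab, smul_eq_mul] at h₁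
  rw [← inner_sub_right, ← hv, real_inner_self_eq_norm_sq] at h₁
  rcases eq_or_lt_of_le (norm_nonneg v) with h0 | h0
  · rw [← h0]
    rcases eq_or_lt_of_le hab with rfl | hlt
    · simp
    -- For `v = 0` it remains to see `0 ≤ D`, for which a single point with `‖f' t‖ ≤ D` suffices.
    · have : (volume.restrict (Icc a b)) ≠ 0 := by
        simp [Measure.restrict_eq_zero, hlt]
      have : (ae (volume.restrict (Icc a b))).NeBot := ae_neBot.2 this
      obtain ⟨t, ht⟩ := hd.exists
      exact mul_nonneg ((norm_nonneg _).trans ht.2) (sub_nonneg.2 hab)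
  · nlinarith

end AbsolutelyContinuous

/-! ### Hybrid time domains -/

/-- `t` lists the initial times of the intervals that make up `E`. -/
structure IsStartTimes (E : Set (ℝ × ℕ)) (t : ℕ → ℝ) : Prop where
  zero : t 0 = 0
  mono : Monotone t
  zero_mem : ((0 : ℝ), 0) ∈ E
  start_le : ∀ {s : ℝ} {j : ℕ}, (s, j) ∈ E → t j ≤ s
  mem_of_le : ∀ {s r : ℝ} {j : ℕ}, (s, j) ∈ E → t j ≤ r → r ≤ s → (r, j) ∈ E
  end_mem : ∀ {s : ℝ} {j : ℕ}, (s, j + 1) ∈ E → (t (j + 1), j) ∈ E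
  le_end : ∀ {s s' : ℝ} {j : ℕ}, (s, j) ∈ E → (s', j + 1) ∈ E → s ≤ t (j + 1)

/-- This treats all shapes of domains alike: `t (j + 1)` is claimed to end interval `j` only when
interval `j + 1` is present, so the shape of the last interval does not matter. -/
theorem IsHybridTimeDomain.exists_isStartTimes {E : Set (ℝ × ℕ)} (hE : IsHybridTimeDomain E) :
    ∃ t, IsStartTimes E t := by
  obtain ⟨t, h0, hm, rfl | ⟨J, last, hl, rfl⟩⟩ := hE
  · refine ⟨t, h0, hm, ?_, ?_, ?_, ?_, ?_⟩
    · simpa [h0] using hm (Nat.zero_le 1)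
    · exact fun h => h.1
    · exact fun h h1 h2 => ⟨h1, h2.trans h.2⟩
    · exact fun {s j} _ => ⟨hm (Nat.le_succ j), le_rfl⟩
    · exact fun h _ => h.2
  · have hJ : t J ∈ last := by
      rcases hl with rfl | ⟨h, rfl⟩ | rfl
      · exact ⟨le_rfl, hm (Nat.le_succ J)⟩
      · exact ⟨le_rfl, h⟩
      · exact self_mem_Ici
    have hlast : ∀ {s r : ℝ}, s ∈ last → t J ≤ r → r ≤ s → r ∈ last := by
      rcases hl with rfl | ⟨h, rfl⟩ | rfl
      · exact fun h h1 h2 => ⟨h1, h2.trans h.2⟩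
      · exact fun h h1 h2 => ⟨h1, h2.trans_lt h.2⟩
      · exact fun _ h1 _ => h1
    have hge : ∀ {s : ℝ}, s ∈ last → t J ≤ s := by
      rcases hl with rfl | ⟨h, rfl⟩ | rfl
      · exact fun h => h.1
      · exact fun h => h.1
      · exact fun h => h
    refine ⟨t, h0, hm, ?_, ?_, ?_, ?_, ?_⟩
    · rcases Nat.eq_zero_or_pos J with rfl | h
      · exact Or.inr ⟨rfl, by simpa [h0] using hJ⟩
      · exact Or.inl ⟨h, by simpa [h0] using hm (Nat.zero_le 1)⟩
    · rintro s j (⟨_, h⟩ | ⟨h, h'⟩)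
      · exact h.1
      · simp only at h h'
        subst h
        exact hge h'
    · rintro s r j (⟨h', h⟩ | ⟨h, h'⟩) h1 h2
      · exact Or.inl ⟨h', h1, h2.trans h.2⟩
      · simp only at h h'
        subst h
        exact Or.inr ⟨rfl, hlast h' h1 h2⟩
    · rintro s j (⟨h, _⟩ | ⟨h, _⟩) <;> simp only at h <;>
        exact Or.inl ⟨by simp only; omega, hm (Nat.le_succ j), le_rfl⟩
    · rintro s s' j (⟨_, h⟩ | ⟨h, _⟩) h'
      · exact h.2
      · rcases h' with ⟨h', _⟩ | ⟨h', _⟩ <;> simp only at h h' <;> omega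

namespace IsStartTimes

variable {E : Set (ℝ × ℕ)} {t : ℕ → ℝ}

theorem start_mem (ht : IsStartTimes E t) {s : ℝ} {j : ℕ} (h : (s, j) ∈ E) : (t j, j) ∈ E :=
  ht.mem_of_le h le_rfl (ht.start_le h)

theorem mem_of_index_le (ht : IsStartTimes E t) {s : ℝ} {i j : ℕ} (hij : i ≤ j) (h : (s, j) ∈ E) :
    (t i, i) ∈ E := by
  induction j, hij using Nat.le_induction generalizing s with
  | base => exact ht.start_mem h
  | succ j _ ih => exact ih (ht.end_mem h)

theorem le_start_of_lt (ht : IsStartTimes E t) {s s' : ℝ} {i j : ℕ} (hij : i < j)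
    (h : (s, i) ∈ E) (h' : (s', j) ∈ E) : s ≤ t j :=
  (ht.le_end h (ht.mem_of_index_le (Nat.succ_le_of_lt hij) h')).trans (ht.mono hij)

theorem nonneg (ht : IsStartTimes E t) {s : ℝ} {j : ℕ} (h : (s, j) ∈ E) : 0 ≤ s :=
  (ht.zero ▸ ht.mono (Nat.zero_le j)).trans (ht.start_le h)

variable {V : Type} {φ : HybridSignal V}

theorem Icc_subset_slice (ht : IsStartTimes φ.dom t) {s : ℝ} {j : ℕ} (h : (s, j) ∈ φ.dom) :
    Icc (t j) s ⊆ φ.slice j := fun _ hr => ht.mem_of_le h hr.1 hr.2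

theorem ordConnected_slice (ht : IsStartTimes φ.dom t) (j : ℕ) : (φ.slice j).OrdConnected :=
  ⟨fun _ ha _ hb _ hr => ht.mem_of_le hb ((ht.start_le ha).trans hr.1) hr.2⟩

theorem interior_slice_subset (ht : IsStartTimes φ.dom t) (j : ℕ) :
    interior (φ.slice j) ⊆ Ioi (t j) := by
  rw [← interior_Ici]
  exact interior_mono fun s hs => ht.start_le hs

/-- A convex set has null frontier. Integrals over slices can thus be taken over the interiors,
which are pairwise disjoint and on which `firstIdx` is constant. -/
theorem interior_slice_ae_eq (ht : IsStartTimes φ.dom t) (j : ℕ) :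
    interior (φ.slice j) =ᵐ[volume] φ.slice j :=
  interior_ae_eq_of_null_frontier
    (Convex.addHaar_frontier volume (convex_iff_ordConnected.2 (ht.ordConnected_slice j)))

theorem firstIdx_eq (ht : IsStartTimes φ.dom t) {s : ℝ} {j : ℕ} (hs : s ∈ interior (φ.slice j)) :
    φ.firstIdx s = j := by
  have hj : (s, j) ∈ φ.dom := (interior_subset hs : s ∈ φ.slice j)
  refine le_antisymm (Nat.sInf_le hj) (le_csInf ⟨j, hj⟩ fun i hi => ?_)
  by_contra h
  exact absurd (ht.le_start_of_lt (not_le.1 h) hi hj)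
    (not_le.2 (ht.interior_slice_subset j hs))

theorem disjoint_interior_slice (ht : IsStartTimes φ.dom t) :
    Pairwise (Function.onFun Disjoint fun j => interior (φ.slice j)) := by
  intro i j hij
  refine Set.disjoint_left.2 fun s hi hj => hij ?_
  rw [← ht.firstIdx_eq hi, ← ht.firstIdx_eq hj]

end IsStartTimes

/-- A bound on integrals over compact initial pieces of a slice passes to the slice. -/
theorem IsStartTimes.lintegral_slice_le {V : Type} {φ : HybridSignal V} {t : ℕ → ℝ}
    (ht : IsStartTimes φ.dom t) {j : ℕ} {f : ℝ → ℝ≥0∞} {b : ℝ≥0∞}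
    (h : ∀ s, (s, j) ∈ φ.dom → ∫⁻ r in Icc (t j) s, f r ≤ b) : ∫⁻ r in φ.slice j, f r ≤ b := by
  rw [← Measure.restrict_congr_set (ht.interior_slice_ae_eq j)]
  -- Rational right ends give a countable directed union, for which the integral is the supremum of
  -- the integrals.
  have hsub : interior (φ.slice j) ⊆ ⋃ q : {q : ℚ // (q : ℝ) ∈ φ.slice j}, Icc (t j) (q : ℝ) := by
    intro s hs
    obtain ⟨e, he, hball⟩ := Metric.isOpen_iff.1 isOpen_interior s hs
    obtain ⟨q, hq, hq'⟩ := exists_rat_btwn (show s < s + e by linarith)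
    have hqm : (q : ℝ) ∈ φ.slice j := by
      refine interior_subset (hball ?_)
      rw [Metric.mem_ball, Real.dist_eq, abs_of_nonneg] <;> linarith
    exact mem_iUnion.2 ⟨⟨q, hqm⟩, (ht.interior_slice_subset j hs).le, hq.le⟩
  refine (lintegral_mono_set hsub).trans ?_
  rw [setLIntegral_iUnion_of_directed]
  · exact iSup_le fun q => h _ q.2
  · intro p q
    rcases le_total p.1 q.1 with hpq | hpq
    · exact ⟨q, Icc_subset_Icc_right (by exact_mod_cast hpq), subset_rfl⟩
    · exact ⟨p, subset_rfl, Icc_subset_Icc_right (by exact_mod_cast hpq)⟩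

/-- The domain with start times `t`, index of the last interval `J`, and last interval `last`. -/
def cutDomain (t : ℕ → ℝ) (J : ℕ) (last : Set ℝ) : Set (ℝ × ℕ) :=
  {p | (p.2 < J ∧ p.1 ∈ Icc (t p.2) (t (p.2 + 1))) ∨ (p.2 = J ∧ p.1 ∈ last)}

theorem mem_cutDomain_of_lt {t : ℕ → ℝ} {J j : ℕ} {last : Set ℝ} {s : ℝ} (h : j < J) :
    (s, j) ∈ cutDomain t J last ↔ s ∈ Icc (t j) (t (j + 1)) := by
  simp [cutDomain, h, h.ne]

theorem mem_cutDomain_self {t : ℕ → ℝ} {J : ℕ} {last : Set ℝ} {s : ℝ} :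
    (s, J) ∈ cutDomain t J last ↔ s ∈ last := by
  simp [cutDomain]

theorem notMem_cutDomain_of_gt {t : ℕ → ℝ} {J j : ℕ} {last : Set ℝ} {s : ℝ} (h : J < j) :
    (s, j) ∉ cutDomain t J last := by
  simp only [cutDomain, mem_ofPred_eq]
  omega

theorem isHybridTimeDomain_cutDomain {t : ℕ → ℝ} (h0 : t 0 = 0) (hm : Monotone t) (J : ℕ) {b : ℝ}
    (hb : t J ≤ b) : IsHybridTimeDomain (cutDomain t J (Icc (t J) b)) := by
  -- The start time of index `J + 1` has to be the right end `b` of the last interval; later ones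
  -- only need monotonicity.
  refine ⟨fun k => if k ≤ J then t k else b, by simp [h0], ?_, Or.inr ⟨J, Icc (t J) b, ?_, ?_⟩⟩
  · intro i k hik
    simp only
    split_ifs with h1 h2 h2
    · exact hm hik
    · exact (hm h1).trans hb
    · omega
    · exact le_rfl
  · left
    simp
  · ext ⟨s, j⟩
    simp only [cutDomain, mem_ofPred_eq]
    refine or_congr (and_congr_right fun h => ?_) Iff.rfl
    rw [if_pos h.le, if_pos (Nat.succ_le_of_lt h)]

/-- An incomplete hybrid signal has a last interval, and this interval is bounded. -/
theorem HybridSignal.exists_dom_eq_cutDomain {V : Type} {φ : HybridSignal V}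
    (h : ¬ φ.IsComplete) :
    ∃ (t : ℕ → ℝ) (J : ℕ) (last : Set ℝ), t 0 = 0 ∧ Monotone t ∧ φ.dom = cutDomain t J last ∧
      (last = Icc (t J) (t (J + 1)) ∨ (t J < t (J + 1) ∧ last = Ico (t J) (t (J + 1)))) := by
  obtain ⟨t, h0, hm, hE | ⟨J, last, hl, hE⟩⟩ := φ.isDomain
  · refine absurd (fun R => ?_) h
    obtain ⟨n, hn⟩ := exists_nat_ge R
    refine ⟨(t n, n), ?_, ?_⟩
    · rw [hE]
      exact ⟨le_rfl, hm (Nat.le_succ n)⟩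
    · have : 0 ≤ t n := h0 ▸ hm (Nat.zero_le n)
      simp only
      linarith
  · rcases hl with hl | hl | rfl
    · exact ⟨t, J, last, h0, hm, hE, Or.inl hl⟩
    · exact ⟨t, J, last, h0, hm, hE, Or.inr hl⟩
    · refine absurd (fun R => ⟨(max R (t J), J), ?_, ?_⟩) h
      · rw [hE]
        exact Or.inr ⟨rfl, le_max_right R (t J)⟩
      · have := le_max_left R (t J)
        have : (0 : ℝ) ≤ J := J.cast_nonneg
        simp only
        linarith

/-! ### Extending solution pairs -/

namespace HybridSystem

variable {ι κ μ : Type} [Fintype ι] [Fintype κ] [Fintype μ] {S : HybridSystem ι κ μ}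

/-- Prolonging the last interval of a solution pair. -/
theorem IsMaximalPair.mem_last_of_flow {φ : HybridSignal (Vec ι)} {u : HybridSignal (Vec (κ ⊕ μ))}
    (hφ : S.IsMaximalPair φ u) {t : ℕ → ℝ} (h0 : t 0 = 0) (hm : Monotone t) {J : ℕ} {last : Set ℝ}
    (hdom : φ.dom = cutDomain t J last) (hJ : t J ∈ last) {b : ℝ} (hb : last ⊆ Icc (t J) b)
    {f : ℝ → Vec ι} {g : ℝ → Vec (κ ⊕ μ)} (hf : ∀ s ∈ last, f s = φ.val s J)
    (hg : ∀ s ∈ last, g s = u.val s J) (hac : AbsolutelyContinuousOnInterval f (t J) b)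
    (hgm : AEMeasurable g (volume.restrict (Icc (t J) b)))
    (hgb : ∃ M : ℝ, ∀ᵐ s ∂(volume.restrict (Icc (t J) b)), ‖g s‖ ≤ M)
    (hmem : ∀ s ∈ Ioo (t J) b, f s ∈ S.flowSet)
    (hder : ∀ᵐ s ∂(volume.restrict (Icc (t J) b)), HasDerivAt f (S.flowMap (f s) (g s).first) s) :
    b ∈ last := by
  obtain ⟨hS, hmax⟩ := hφ
  have hJb : t J ≤ b := (hb hJ).2
  let E := cutDomain t J (Icc (t J) b)
  have hE : IsHybridTimeDomain E := isHybridTimeDomain_cutDomain h0 hm J hJb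
  have hsub : cutDomain t J last ⊆ E := by
    rintro ⟨s, j⟩ (h | h)
    · exact Or.inl h
    · exact Or.inr ⟨h.1, hb h.2⟩
  let φ' : HybridSignal (Vec ι) := ⟨E, hE, fun s j => if j = J then f s else φ.val s j⟩
  let u' : HybridSignal (Vec (κ ⊕ μ)) := ⟨E, hE, fun s j => if j = J then g s else u.val s j⟩
  have hsliceJ : φ'.slice J = Icc (t J) b := by
    ext s
    exact mem_cutDomain_self
  have hslice : ∀ j, j ≠ J → φ'.slice j = φ.slice j := by
    intro j hj
    ext s
    change (s, j) ∈ E ↔ (s, j) ∈ φ.dom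
    rw [hdom]
    rcases lt_or_gt_of_ne hj with h | h
    · rw [mem_cutDomain_of_lt h, mem_cutDomain_of_lt h]
    · exact iff_of_false (notMem_cutDomain_of_gt h) (notMem_cutDomain_of_gt h)
  have hextφ : φ'.Extends φ := by
    refine ⟨hdom ▸ hsub, fun s j hs => ?_⟩
    by_cases hj : j = J
    · subst hj
      rw [hdom, mem_cutDomain_self] at hs
      simp [φ', hf s hs]
    · simp [φ', hj]
  have hextu : u'.Extends u := by
    refine ⟨hS.dom_eq ▸ hdom ▸ hsub, fun s j hs => ?_⟩
    by_cases hj : j = J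
    · subst hj
      rw [← hS.dom_eq, hdom, mem_cutDomain_self] at hs
      simp [u', hg s hs]
    · simp [u', hj]
  have h00 : ((0 : ℝ), 0) ∈ φ.dom := by
    obtain ⟨_, h⟩ := φ.isDomain.exists_isStartTimes
    exact h.zero_mem
  have hsol : S.IsSolutionPair φ' u' := by
    refine ⟨?_, ?_, rfl, ?_, ?_, ?_, ?_⟩
    · intro j a c hac' hsl
      by_cases hj : j = J
      · subst hj
        rw [hsliceJ] at hsl
        simp only [φ', if_true]
        refine hac.mono ?_
        rwa [uIcc_of_le hac', uIcc_of_le hJb]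
      · rw [hslice j hj] at hsl
        simpa only [φ', if_neg hj] using hS.arc j a c hac' hsl
    · intro j
      by_cases hj : j = J
      · subst hj
        have : u'.slice j = Icc (t j) b := hsliceJ
        simp only [this, u', if_true]
        refine ⟨hgm, fun R => ?_⟩
        obtain ⟨M, hM⟩ := hgb
        exact ⟨M, ae_restrict_of_ae_restrict_of_subset inter_subset_left hM⟩
      · have : u'.slice j = u.slice j := (hslice j hj).trans (by simp [HybridSignal.slice, hS.dom_eq])
        simp only [this, u', if_neg hj]
        exact hS.input j
    · rw [hextφ.2 0 0 h00]
      exact hS.init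
    · intro j s hs
      by_cases hj : j = J
      · subst hj
        rw [hsliceJ, interior_Icc] at hs
        simpa only [φ', if_true] using hmem s hs
      · rw [hslice j hj] at hs
        simpa only [φ', if_neg hj] using hS.flow_mem j s hs
    · intro j
      by_cases hj : j = J
      · subst hj
        simpa only [hsliceJ, φ', u', if_true] using hder
      · simpa only [hslice j hj, φ', u', if_neg hj] using hS.flow_deriv j
    · rintro ⟨s, j⟩ ⟨h1, h2⟩
      have hjJ : j < J := by
        by_contra h
        exact notMem_cutDomain_of_gt (by omega) h2
      have h1' : (s, j) ∈ φ.dom := by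
        rwa [hdom, mem_cutDomain_of_lt hjJ, ← mem_cutDomain_of_lt hjJ (last := Icc (t J) b)]
      have h2' : (s, j + 1) ∈ φ.dom := by
        -- The prolonged interval creates no new jump: a jump into index `J` can only occur at its
        -- left end `t J`, which was already in `last`.
        by_cases h : j + 1 = J
        · have h3 := (mem_cutDomain_of_lt hjJ).1 h1
          have h4 := h ▸ h2
          simp only [φ', E] at h4
          rw [mem_cutDomain_self] at h4
          rw [hdom, h, mem_cutDomain_self]
          have : s = t J := le_antisymm (h ▸ h3.2) h4.1
          exact this ▸ hJ
        · have : j + 1 < J := by omega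
          rwa [hdom, mem_cutDomain_of_lt this, ← mem_cutDomain_of_lt this (last := Icc (t J) b)]
      have h3 := hS.jump (s, j) ⟨h1', h2'⟩
      simp only at h3 ⊢
      rwa [hextφ.2 _ _ h1', hextφ.2 _ _ h2', hextu.2 _ _ (hS.dom_eq ▸ h1')]
  have := hmax φ' u' hsol hextφ hextu
  have hbE : (b, J) ∈ φ'.dom := mem_cutDomain_self.2 ⟨hJb, le_rfl⟩
  rwa [this, hdom, mem_cutDomain_self] at hbE

/-- A solution pair whose last interval is closed and ends in the jump set can be extended. -/
theorem not_isMaximalPair_of_jump {φ : HybridSignal (Vec ι)} {u : HybridSignal (Vec (κ ⊕ μ))}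
    (hS : S.IsSolutionPair φ u) {t : ℕ → ℝ} (h0 : t 0 = 0) (hm : Monotone t) {J : ℕ}
    (hdom : φ.dom = cutDomain t J (Icc (t J) (t (J + 1))))
    (hD : φ.val (t (J + 1)) J ∈ S.jumpSet)
    (hG : (S.jumpMap (φ.val (t (J + 1)) J) (u.val (t (J + 1)) J).second).Nonempty) :
    ¬ S.IsMaximalPair φ u := by
  rintro ⟨-, hmax⟩
  obtain ⟨x, hx⟩ := hG
  set T := t (J + 1) with hT
  let E := cutDomain t (J + 1) (Icc T T)
  have hE : IsHybridTimeDomain E := isHybridTimeDomain_cutDomain h0 hm (J + 1) le_rfl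
  have hEdom : ∀ s j, j ≠ J + 1 → ((s, j) ∈ E ↔ (s, j) ∈ φ.dom) := by
    intro s j hj
    rw [hdom]
    rcases lt_trichotomy j J with h | h | h
    · rw [mem_cutDomain_of_lt h, mem_cutDomain_of_lt (by omega)]
    · subst h
      rw [mem_cutDomain_self, mem_cutDomain_of_lt (by omega)]
    · exact iff_of_false (notMem_cutDomain_of_gt (by omega)) (notMem_cutDomain_of_gt h)
  have hnot : ∀ {s j}, (s, j) ∈ φ.dom → j ≠ J + 1 := by
    rintro s j hs rfl
    rw [hdom] at hs
    exact notMem_cutDomain_of_gt (Nat.lt_succ_self J) hs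
  let φ' : HybridSignal (Vec ι) := ⟨E, hE, fun s j => if j = J + 1 then x else φ.val s j⟩
  -- The jump reads the input at `(T, J)`, so the input value after the jump is arbitrary.
  let u' : HybridSignal (Vec (κ ⊕ μ)) := ⟨E, hE, fun s j => if j = J + 1 then 0 else u.val s j⟩
  have hsliceJ : φ'.slice (J + 1) = {T} := by
    ext s
    refine mem_cutDomain_self.trans ?_
    simp
  have hslice : ∀ j, j ≠ J + 1 → φ'.slice j = φ.slice j := fun j hj => by
    ext s
    exact hEdom s j hj
  have hextφ : φ'.Extends φ :=
    ⟨fun p hp => (hEdom p.1 p.2 (hnot hp)).2 hp, fun s j hs => by simp [φ', hnot hs]⟩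
  have hextu : u'.Extends u := by
    refine ⟨hS.dom_eq ▸ hextφ.1, fun s j hs => ?_⟩
    rw [← hS.dom_eq] at hs
    simp [u', hnot hs]
  have h00 : ((0 : ℝ), 0) ∈ φ.dom := by
    obtain ⟨_, h⟩ := φ.isDomain.exists_isStartTimes
    exact h.zero_mem
  have hsol : S.IsSolutionPair φ' u' := by
    refine ⟨?_, ?_, rfl, ?_, ?_, ?_, ?_⟩
    · intro j a c hac' hsl
      by_cases hj : j = J + 1
      · subst hj
        simp only [φ', if_true]
        exact (LipschitzWith.const x).lipschitzOnWith.absolutelyContinuousOnInterval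
      · rw [hslice j hj] at hsl
        simpa only [φ', if_neg hj] using hS.arc j a c hac' hsl
    · intro j
      by_cases hj : j = J + 1
      · subst hj
        simp only [u', if_true]
        exact ⟨aemeasurable_const, fun R => ⟨0, by simp⟩⟩
      · have : u'.slice j = u.slice j := (hslice j hj).trans (by simp [HybridSignal.slice, hS.dom_eq])
        simp only [this, u', if_neg hj]
        exact hS.input j
    · rw [hextφ.2 0 0 h00]
      exact hS.init
    · intro j s hs
      by_cases hj : j = J + 1
      · subst hj
        rw [hsliceJ, interior_singleton] at hs
        exact hs.elim
      · rw [hslice j hj] at hs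
        simpa only [φ', if_neg hj] using hS.flow_mem j s hs
    · intro j
      by_cases hj : j = J + 1
      · subst hj
        rw [hsliceJ, Measure.restrict_singleton]
        simp
      · simpa only [hslice j hj, φ', u', if_neg hj] using hS.flow_deriv j
    · rintro ⟨s, j⟩ ⟨h1, h2⟩
      have hjJ : j < J + 1 := by
        by_contra h
        exact notMem_cutDomain_of_gt (by omega) h2
      have h1' : (s, j) ∈ φ.dom := (hEdom s j hjJ.ne).1 h1
      simp only
      rw [hextφ.2 _ _ h1', hextu.2 _ _ (hS.dom_eq ▸ h1')]
      by_cases h : j = J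
      · subst h
        have h3 : s = T := by
          have := mem_cutDomain_self.1 h2
          simpa using this
        subst h3
        simpa [φ'] using ⟨hD, hx⟩
      · have h2' : (s, j + 1) ∈ φ.dom := (hEdom s (j + 1) (by omega)).1 h2
        rw [hextφ.2 _ _ h2']
        exact hS.jump (s, j) ⟨h1', h2'⟩
  have := hmax φ' u' hsol hextφ hextu
  have hbE : (T, J + 1) ∈ φ'.dom := mem_cutDomain_self.2 ⟨le_rfl, le_rfl⟩
  rw [this] at hbE
  exact hnot hbE rfl

end HybridSystem

/-! ### Vectors and matrices -/

section Vec

variable {ι κ : Type}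

theorem mulV_ofLp [Fintype κ] (M : Matrix ι κ ℝ) (x : Vec κ) : (mulV M x).ofLp = M *ᵥ x.ofLp := rfl

@[simp]
theorem stack_first (a : Vec ι) (b : Vec κ) : (Vec.stack a b).first = a := rfl

@[simp]
theorem stack_second (a : Vec ι) (b : Vec κ) : (Vec.stack a b).second = b := rfl

variable [Fintype ι] [Fintype κ]

theorem real_inner_eq_dotProduct (x y : Vec ι) : inner ℝ x y = x.ofLp ⬝ᵥ y.ofLp := by
  rw [EuclideanSpace.inner_eq_star_dotProduct, dotProduct_comm]
  simp

theorem norm_sq_eq_first_add_second (x : Vec (ι ⊕ κ)) :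
    ‖x‖ ^ 2 = ‖x.first‖ ^ 2 + ‖x.second‖ ^ 2 := by
  simp [EuclideanSpace.real_norm_sq_eq, Vec.first, Vec.second]

theorem norm_first_le (x : Vec (ι ⊕ κ)) : ‖x.first‖ ≤ ‖x‖ :=
  le_of_sq_le_sq (by rw [norm_sq_eq_first_add_second x]; nlinarith [sq_nonneg ‖x.second‖])
    (norm_nonneg x)

theorem norm_second_le (x : Vec (ι ⊕ κ)) : ‖x.second‖ ≤ ‖x‖ :=
  le_of_sq_le_sq (by rw [norm_sq_eq_first_add_second x]; nlinarith [sq_nonneg ‖x.first‖])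
    (norm_nonneg x)

/-- `Vec.first` as a continuous linear map. -/
noncomputable def firstL (ι κ : Type) [Fintype ι] [Fintype κ] : Vec (ι ⊕ κ) →L[ℝ] Vec ι :=
  LinearMap.toContinuousLinearMap
    { toFun := Vec.first
      map_add' := fun _ _ => rfl
      map_smul' := fun _ _ => rfl }

/-- `Vec.second` as a continuous linear map. -/
noncomputable def secondL (ι κ : Type) [Fintype ι] [Fintype κ] : Vec (ι ⊕ κ) →L[ℝ] Vec κ :=
  LinearMap.toContinuousLinearMap
    { toFun := Vec.second
      map_add' := fun _ _ => rfl
      map_smul' := fun _ _ => rfl }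

/-- `mulV` as a continuous linear map. -/
noncomputable def mulVL (M : Matrix ι κ ℝ) : Vec κ →L[ℝ] Vec ι :=
  LinearMap.toContinuousLinearMap
    { toFun := mulV M
      map_add' := fun x y => by
        ext i
        exact congrFun (Matrix.mulVec_add M _ _) i
      map_smul' := fun c x => by
        ext i
        exact congrFun (Matrix.mulVec_smul M c _) i }

theorem mulVL_apply (M : Matrix ι κ ℝ) (x : Vec κ) : mulVL M x = mulV M x := rfl

theorem norm_mulV_le (M : Matrix ι κ ℝ) (x : Vec κ) : ‖mulV M x‖ ≤ ‖mulVL M‖ * ‖x‖ :=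
  (mulVL M).le_opNorm x

theorem norm_stack_sq (a : Vec ι) (b : Vec κ) : ‖Vec.stack a b‖ ^ 2 = ‖a‖ ^ 2 + ‖b‖ ^ 2 := by
  rw [norm_sq_eq_first_add_second, stack_first, stack_second]

/-- Quadratic forms of positive definite matrices are coercive. -/
theorem exists_pos_mul_norm_sq_le [DecidableEq ι] {M : Matrix ι ι ℝ} (hM : M.PosDef) :
    ∃ c > (0 : ℝ), ∀ x : Vec ι, c * ‖x‖ ^ 2 ≤ inner ℝ x (mulV M x) := by
  have hpos : ∀ x : Vec ι, x ≠ 0 → 0 < inner ℝ x (mulV M x) := by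
    intro x hx
    rw [real_inner_eq_dotProduct, mulV_ofLp]
    have := hM.dotProduct_mulVec_pos (x := x.ofLp) (by simpa using hx)
    simpa using this
  rcases (Metric.sphere (0 : Vec ι) 1).eq_empty_or_nonempty with h | h
  -- An empty unit sphere means that the space is trivial, and any constant works.
  · refine ⟨1, one_pos, fun x => ?_⟩
    have hx : x = 0 := by
      by_contra hx
      have : ‖x‖⁻¹ • x ∈ Metric.sphere (0 : Vec ι) 1 := by
        simp [norm_smul, norm_ne_zero_iff.2 hx]
      rw [h] at this
      exact this
    simp [hx]
  · have hcont : Continuous fun x : Vec ι => inner ℝ x (mulVL M x) :=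
      continuous_id.inner (mulVL M).continuous
    obtain ⟨x₀, hx₀, hmin⟩ := (isCompact_sphere (0 : Vec ι) 1).exists_isMinOn h hcont.continuousOn
    have hx₀' : x₀ ≠ 0 := by
      rintro rfl
      simp at hx₀
    refine ⟨_, hpos x₀ hx₀', fun x => ?_⟩
    rcases eq_or_ne x 0 with rfl | hx
    · simp
    · have hn : ‖x‖ ≠ 0 := norm_ne_zero_iff.2 hx
      have h1 : ‖x‖⁻¹ • x ∈ Metric.sphere (0 : Vec ι) 1 := by simp [norm_smul, hn]
      have h2 : inner ℝ x₀ (mulVL M x₀) ≤ inner ℝ (‖x‖⁻¹ • x) (mulVL M (‖x‖⁻¹ • x)) := hmin h1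
      rw [map_smul, real_inner_smul_left, real_inner_smul_right, mulVL_apply, mulVL_apply] at h2
      calc inner ℝ x₀ (mulV M x₀) * ‖x‖ ^ 2
          ≤ ‖x‖⁻¹ * (‖x‖⁻¹ * inner ℝ x (mulV M x)) * ‖x‖ ^ 2 := by gcongr
        _ = inner ℝ x (mulV M x) := by field_simp

theorem inner_mulV_self_le (M : Matrix ι ι ℝ) (x : Vec ι) :
    inner ℝ x (mulV M x) ≤ ‖mulVL M‖ * ‖x‖ ^ 2 := by
  refine (real_inner_le_norm _ _).trans ?_
  nlinarith [norm_mulV_le M x, norm_nonneg x]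

end Vec

/-! ### Components of the state and the distance to the attractor -/

section State

variable {nz ny : ℕ}

/-- `ε`. -/
def epsPart (x : Vec (StateIdx nz ny)) : Vec (Fin nz) := (errPart x).first

/-- `θ̃`. -/
def thetaPart (x : Vec (StateIdx nz ny)) : Vec (Fin ny) := (errPart x).second

/-- `epsPart` as a continuous linear map. -/
noncomputable def epsL (nz ny : ℕ) : Vec (StateIdx nz ny) →L[ℝ] Vec (Fin nz) :=
  (firstL _ _).comp ((firstL _ _).comp (secondL _ _))

/-- `thetaPart` as a continuous linear map. -/
noncomputable def thetaL (nz ny : ℕ) : Vec (StateIdx nz ny) →L[ℝ] Vec (Fin ny) :=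
  (secondL _ _).comp ((firstL _ _).comp (secondL _ _))

/-- `timer` as a continuous linear map. -/
noncomputable def timerL (nz ny : ℕ) : Vec (StateIdx nz ny) →L[ℝ] ℝ :=
  (EuclideanSpace.proj (0 : Fin 1)).comp ((secondL _ _).comp (secondL _ _))

theorem epsL_apply (x : Vec (StateIdx nz ny)) : epsL nz ny x = epsPart x := rfl

theorem thetaL_apply (x : Vec (StateIdx nz ny)) : thetaL nz ny x = thetaPart x := rfl

theorem timerL_apply (x : Vec (StateIdx nz ny)) : timerL nz ny x = timer x := rfl

theorem norm_errPart_sq (x : Vec (StateIdx nz ny)) :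
    ‖errPart x‖ ^ 2 = ‖epsPart x‖ ^ 2 + ‖thetaPart x‖ ^ 2 := norm_sq_eq_first_add_second _

@[simp]
theorem errPart_mkState (z : Vec (Fin nz)) (e : Vec (Fin nz ⊕ Fin ny)) (τ : ℝ) :
    errPart (mkState z e τ) = e := rfl

theorem norm_zPart_le (x : Vec (StateIdx nz ny)) : ‖zPart x‖ ≤ ‖x‖ := norm_first_le x

theorem norm_errPart_le (x : Vec (StateIdx nz ny)) : ‖errPart x‖ ≤ ‖x‖ :=
  (norm_first_le _).trans (norm_second_le x)

theorem mkState_sub_mkState (z z' : Vec (Fin nz)) (e e' : Vec (Fin nz ⊕ Fin ny)) (τ τ' : ℝ) :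
    mkState z e τ - mkState z' e' τ' = mkState (z - z') (e - e') (τ - τ') := by
  ext i
  rcases i with i | i | i <;> rfl

theorem mkState_eta (x : Vec (StateIdx nz ny)) : mkState (zPart x) (errPart x) (timer x) = x := by
  ext i
  rcases i with i | i | i
  · rfl
  · rfl
  · obtain rfl : i = 0 := Subsingleton.elim _ _
    rfl

theorem norm_mkState_sq (z : Vec (Fin nz)) (e : Vec (Fin nz ⊕ Fin ny)) (τ : ℝ) :
    ‖mkState z e τ‖ ^ 2 = ‖z‖ ^ 2 + (‖e‖ ^ 2 + τ ^ 2) := by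
  rw [mkState, norm_stack_sq, norm_stack_sq]
  simp [EuclideanSpace.real_norm_sq_eq]

theorem norm_mkState_le (z : Vec (Fin nz)) (e : Vec (Fin nz ⊕ Fin ny)) (τ : ℝ) :
    ‖mkState z e τ‖ ≤ ‖z‖ + ‖e‖ + |τ| := by
  refine le_of_sq_le_sq ?_ (by positivity)
  rw [norm_mkState_sq, ← sq_abs τ]
  nlinarith [mul_nonneg (norm_nonneg z) (norm_nonneg e), mul_nonneg (norm_nonneg z) (abs_nonneg τ),
    mul_nonneg (norm_nonneg e) (abs_nonneg τ)]

/-- On states with timer in `[0, T₂]` the distance to the attractor is the norm of the error. -/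
theorem infDist_attractor {T₂ : ℝ} {x : Vec (StateIdx nz ny)} (hx : timer x ∈ Icc 0 T₂) :
    Metric.infDist x (Plant.attractor nz ny T₂) = ‖errPart x‖ := by
  -- A nearest point of the attractor keeps `z` and `τ` and sets the error to zero.
  have hmem : mkState (zPart x) 0 (timer x) ∈ Plant.attractor nz ny T₂ := ⟨rfl, hx⟩
  refine le_antisymm ((Metric.infDist_le_dist_of_mem hmem).trans ?_)
    ((Metric.le_infDist ⟨_, hmem⟩).2 fun y hy => ?_)
  · nth_rewrite 1 [← mkState_eta x]
    rw [dist_eq_norm, mkState_sub_mkState]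
    simpa using norm_mkState_le (0 : Vec (Fin nz)) (errPart x) 0
  · rw [dist_eq_norm]
    calc ‖errPart x‖ = ‖errPart (x - y)‖ := by
          have h : errPart (x - y) = errPart x - errPart y := rfl
          rw [h, hy.1, sub_zero]
      _ ≤ ‖x - y‖ := norm_errPart_le _

end State

/-! ### The flow map -/

namespace Plant

variable {nz ny nw nq ns np : ℕ} (P : Plant nz ny nw nq ns np)

/-- The bound does not involve `v₁`, that is, the plant state `z`; hence the error can be estimated
although `z` may be unbounded. -/
theorem norm_zeta_le {ell : ℝ} (hψ : ∀ v₁ v₂, ‖P.ψ v₁ - P.ψ v₂‖ ≤ ell * ‖v₁ - v₂‖)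
    (v₁ v₂ : Vec (Fin nz)) : ‖P.zeta v₁ v₂‖ ≤ ell * ‖mulV P.S v₂‖ := by
  refine (hψ _ _).trans_eq ?_
  rw [← mulVL_apply, ← mulVL_apply, ← mulVL_apply, ← map_sub, sub_sub_cancel]

/-- The flow map is globally Lipschitz. -/
theorem exists_norm_flowMap_sub_le {ell : ℝ} (hell : 0 < ell)
    (hψ : ∀ v₁ v₂, ‖P.ψ v₁ - P.ψ v₂‖ ≤ ell * ‖v₁ - v₂‖) (L : Matrix (Fin nz) (Fin ny) ℝ)
    (H : Matrix (Fin ny) (Fin ny) ℝ) (T₁ T₂ : ℝ) :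
    ∃ K : ℝ, 0 ≤ K ∧ ∀ x y w w',
      ‖(P.errorSystem L H T₁ T₂).flowMap x w - (P.errorSystem L H T₁ T₂).flowMap y w'‖ ≤
        K * (‖x - y‖ + ‖w - w'‖) := by
  set kA := ‖mulVL P.A‖
  set kB := ‖mulVL P.B‖
  set kS := ‖mulVL P.S‖
  set kN := ‖mulVL P.N‖
  set kF := ‖mulVL (P.calF L H)‖
  set kQ := ‖mulVL P.calQ‖
  set kT := ‖mulVL P.calT‖
  have hψS : ∀ v v' : Vec (Fin nz),
      ‖P.ψ (mulV P.S v) - P.ψ (mulV P.S v')‖ ≤ ell * (kS * ‖v - v'‖) := by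
    intro v v'
    refine (hψ _ _).trans ?_
    rw [← mulVL_apply, ← mulVL_apply, ← map_sub]
    gcongr
    exact (mulVL P.S).le_opNorm _
  -- The factor `3` is `1 + 2`: `ζ` contains `ψ` at `S z` and at `S (z - ε)`, and the increment of
  -- `z - ε` is at most `2 ‖x - y‖`.
  refine ⟨kA + kB * (ell * kS) + kN + (kF + kQ * (3 * (ell * kS)) + kT), by positivity,
    fun x y w w' => ?_⟩
  change ‖mkState _ _ _ - mkState _ _ _‖ ≤ _
  rw [mkState_sub_mkState]
  refine (norm_mkState_le _ _ _).trans ?_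
  rw [sub_self, abs_zero, add_zero]
  have hz : ‖zPart x - zPart y‖ ≤ ‖x - y‖ := norm_zPart_le (x - y)
  have he : ‖errPart x - errPart y‖ ≤ ‖x - y‖ := norm_errPart_le (x - y)
  have hε : ‖(errPart x).first - (errPart y).first‖ ≤ ‖x - y‖ :=
    (norm_first_le (errPart (x - y))).trans (norm_errPart_le (x - y))
  have h1 : ‖mulV P.A (zPart x) + mulV P.B (P.ψ (mulV P.S (zPart x))) + mulV P.N w -
      (mulV P.A (zPart y) + mulV P.B (P.ψ (mulV P.S (zPart y))) + mulV P.N w')‖ ≤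
      kA * ‖x - y‖ + kB * (ell * (kS * ‖x - y‖)) + kN * ‖w - w'‖ := by
    have : mulV P.A (zPart x) + mulV P.B (P.ψ (mulV P.S (zPart x))) + mulV P.N w -
        (mulV P.A (zPart y) + mulV P.B (P.ψ (mulV P.S (zPart y))) + mulV P.N w') =
        mulVL P.A (zPart x - zPart y) +
          mulVL P.B (P.ψ (mulV P.S (zPart x)) - P.ψ (mulV P.S (zPart y))) +
          mulVL P.N (w - w') := by
      simp only [map_sub, mulVL_apply]
      abel
    rw [this]
    refine (norm_add₃_le).trans ?_
    gcongr
    · exact ((mulVL P.A).le_opNorm _).trans (by gcongr)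
    · refine ((mulVL P.B).le_opNorm _).trans ?_
      gcongr
      exact (hψS _ _).trans (by gcongr)
    · exact (mulVL P.N).le_opNorm _
  have h2 : ‖mulV (P.calF L H) (errPart x) + mulV P.calQ (P.zeta (zPart x) (errPart x).first)
        + mulV P.calT w - (mulV (P.calF L H) (errPart y) +
        mulV P.calQ (P.zeta (zPart y) (errPart y).first) + mulV P.calT w')‖ ≤
      kF * ‖x - y‖ + kQ * (3 * (ell * (kS * ‖x - y‖))) + kT * ‖w - w'‖ := by
    have : mulV (P.calF L H) (errPart x) + mulV P.calQ (P.zeta (zPart x) (errPart x).first)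
        + mulV P.calT w - (mulV (P.calF L H) (errPart y) +
        mulV P.calQ (P.zeta (zPart y) (errPart y).first) + mulV P.calT w') =
        mulVL (P.calF L H) (errPart x - errPart y) +
          mulVL P.calQ (P.zeta (zPart x) (errPart x).first - P.zeta (zPart y) (errPart y).first) +
          mulVL P.calT (w - w') := by
      simp only [map_sub, mulVL_apply]
      abel
    rw [this]
    refine (norm_add₃_le).trans ?_
    gcongr
    · exact ((mulVL (P.calF L H)).le_opNorm _).trans (by gcongr)
    · refine ((mulVL P.calQ).le_opNorm _).trans ?_
      gcongr
      have h3 : P.zeta (zPart x) (errPart x).first - P.zeta (zPart y) (errPart y).first =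
          (P.ψ (mulV P.S (zPart x)) - P.ψ (mulV P.S (zPart y))) -
          (P.ψ (mulV P.S (zPart x - (errPart x).first)) -
            P.ψ (mulV P.S (zPart y - (errPart y).first))) := by
        simp only [zeta]
        abel
      rw [h3]
      refine (norm_sub_le _ _).trans ?_
      have h4 := hψS (zPart x) (zPart y)
      have h5 := hψS (zPart x - (errPart x).first) (zPart y - (errPart y).first)
      have h6 : ‖zPart x - (errPart x).first - (zPart y - (errPart y).first)‖ ≤
          2 * ‖x - y‖ := by
        rw [sub_sub_sub_comm, two_mul]
        exact (norm_sub_le _ _).trans (add_le_add hz hε)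
      calc _ ≤ ell * (kS * ‖x - y‖) + ell * (kS * (2 * ‖x - y‖)) := by
            refine add_le_add (h4.trans ?_) (h5.trans ?_) <;> gcongr
        _ = _ := by ring
    · exact (mulVL P.calT).le_opNorm _
  refine (add_le_add h1 h2).trans ?_
  have hx := norm_nonneg (x - y)
  have hw := norm_nonneg (w - w')
  have c1 : 0 ≤ kA + kB * (ell * kS) + (kF + kQ * (3 * (ell * kS))) := by positivity
  have c2 : 0 ≤ kN + kT := by positivity
  nlinarith [mul_nonneg c1 hw, mul_nonneg c2 hx]

theorem timer_flowMap (L : Matrix (Fin nz) (Fin ny) ℝ) (H : Matrix (Fin ny) (Fin ny) ℝ)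
    (T₁ T₂ : ℝ) (x : Vec (StateIdx nz ny)) (w : Vec (Fin nw)) :
    timer ((P.errorSystem L H T₁ T₂).flowMap x w) = -1 := rfl

end Plant

namespace Plant

variable {nz ny nw nq ns np : ℕ} (P : Plant nz ny nw nq ns np)

/-! ### The quadratic form of the matrix inequality -/

theorem inner_mulV_transpose {ι κ : Type} [Fintype ι] [Fintype κ] (M : Matrix ι κ ℝ) (x : Vec κ)
    (y : Vec ι) : inner ℝ x (mulV Mᵀ y) = inner ℝ (mulV M x) y := by
  simp only [real_inner_eq_dotProduct, mulV_ofLp]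
  rw [Matrix.dotProduct_mulVec, Matrix.vecMul_transpose]

theorem mulV_mul {ι κ μ : Type} [Fintype κ] [Fintype μ] (M : Matrix ι κ ℝ)
    (N : Matrix κ μ ℝ) (x : Vec μ) : mulV (M * N) x = mulV M (mulV N x) := by
  ext i
  simp [mulV, Matrix.mulVec_mulVec]

theorem mulV_add_matrix {ι κ : Type} [Fintype κ] (M N : Matrix ι κ ℝ) (x : Vec κ) :
    mulV (M + N) x = mulV M x + mulV N x := by
  ext i
  simp [mulV, Matrix.add_mulVec]

theorem mulV_smul_matrix {ι κ : Type} [Fintype κ] (c : ℝ) (M : Matrix ι κ ℝ) (x : Vec κ) :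
    mulV (c • M) x = c • mulV M x := by
  ext i
  simp [mulV, Matrix.smul_mulVec]

theorem mulV_one {ι : Type} [Fintype ι] [DecidableEq ι] (x : Vec ι) :
    mulV (1 : Matrix ι ι ℝ) x = x := by
  ext i
  simp [mulV]

theorem inner_mulV_comm {ι : Type} [Fintype ι] {M : Matrix ι ι ℝ} (hM : Mᵀ = M) (x y : Vec ι) :
    inner ℝ x (mulV M y) = inner ℝ (mulV M x) y := by
  rw [← inner_mulV_transpose, hM]

/-- The quadratic form of a `2 × 2` block matrix. -/
theorem inner_fromBlocks {ι κ : Type} [Fintype ι] [Fintype κ] (M₁₁ : Matrix ι ι ℝ)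
    (M₁₂ : Matrix ι κ ℝ) (M₂₂ : Matrix κ κ ℝ) (a : Vec ι) (b : Vec κ) :
    inner ℝ (Vec.stack a b) (mulV (Matrix.fromBlocks M₁₁ M₁₂ M₁₂ᵀ M₂₂) (Vec.stack a b)) =
      inner ℝ a (mulV M₁₁ a) + 2 * inner ℝ a (mulV M₁₂ b) + inner ℝ b (mulV M₂₂ b) := by
  have h := inner_mulV_transpose M₁₂ b a
  rw [real_inner_comm] at h
  have h' : inner ℝ b (mulV M₁₂ᵀ a) = inner ℝ a (mulV M₁₂ b) := by
    rw [real_inner_comm, h, real_inner_comm]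
  simp only [real_inner_eq_dotProduct, mulV_ofLp] at h' ⊢
  have e : (Vec.stack a b).ofLp = Sum.elim a.ofLp b.ofLp := rfl
  rw [e, Matrix.fromBlocks_mulVec, sumElim_dotProduct_sumElim]
  simp only [Sum.elim_comp_inl, Sum.elim_comp_inr, dotProduct_add]
  rw [h']
  ring

theorem mulV_fromCols {ι κ μ : Type} [Fintype κ] [Fintype μ] (M : Matrix ι κ ℝ)
    (N : Matrix ι μ ℝ) (a : Vec κ) (b : Vec μ) :
    mulV (Matrix.fromCols M N) (Vec.stack a b) = mulV M a + mulV N b := by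
  ext i
  exact congrFun (Matrix.fromCols_mulVec_sumElim M N a.ofLp b.ofLp) i

theorem mulV_fromBlocks {ι κ μ ν : Type} [Fintype μ] [Fintype ν] (M₁₁ : Matrix ι μ ℝ)
    (M₁₂ : Matrix ι ν ℝ) (M₂₁ : Matrix κ μ ℝ) (M₂₂ : Matrix κ ν ℝ) (x : Vec (μ ⊕ ν)) :
    mulV (Matrix.fromBlocks M₁₁ M₁₂ M₂₁ M₂₂) x =
      Vec.stack (mulV M₁₁ x.first + mulV M₁₂ x.second) (mulV M₂₁ x.first + mulV M₂₂ x.second) := by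
  ext i
  refine (congrFun (Matrix.fromBlocks_mulVec M₁₁ M₁₂ M₂₁ M₂₂ x.ofLp) i).trans ?_
  rcases i with i | i <;> rfl

theorem mulV_fromRows {ι κ μ : Type} [Fintype μ] (M : Matrix ι μ ℝ) (N : Matrix κ μ ℝ)
    (x : Vec μ) : mulV (Matrix.fromRows M N) x = Vec.stack (mulV M x) (mulV N x) := by
  ext i
  rcases i with i | i <;> rfl

/-- The part of the quadratic form of `calMred` that does not involve the timer. -/
noncomputable def formOne (lamt ell χ : ℝ) (P₁ : Matrix (Fin nz) (Fin nz) ℝ)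
    (L : Matrix (Fin nz) (Fin ny) ℝ) (ε : Vec (Fin nz)) (θ : Vec (Fin ny)) (ζ : Vec (Fin ns)) : ℝ :=
  2 * inner ℝ (mulV P₁ ε) (mulV (P.A - L * P.C) ε + mulV L θ + mulV P.B ζ) +
    2 * lamt * inner ℝ ε (mulV P₁ ε) + ‖mulV P.Cp ε‖ ^ 2 + χ * ell ^ 2 * ‖mulV P.S ε‖ ^ 2 -
    χ * ‖ζ‖ ^ 2

/-- The factor of `e^{δτ}` in the quadratic form of `calMred`. -/
noncomputable def formTwo (lamt δ : ℝ) (P₂ : Matrix (Fin ny) (Fin ny) ℝ)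
    (L : Matrix (Fin nz) (Fin ny) ℝ) (H : Matrix (Fin ny) (Fin ny) ℝ) (ε : Vec (Fin nz))
    (θ : Vec (Fin ny)) (ζ : Vec (Fin ns)) : ℝ :=
  2 * inner ℝ (mulV P₂ θ) (mulV (P.C * P.A - P.C * L * P.C - H * P.C) ε +
      mulV (P.C * L + H) θ + mulV P.C (mulV P.B ζ)) +
    (2 * lamt - δ) * inner ℝ θ (mulV P₂ θ)

/-- The timer enters only through the factor `e^{δτ}`, and affinely. This is why two values of `τ`
suffice in the matrix inequality. -/
theorem inner_mulV_calMred (lamt ell : ℝ) {P₁ : Matrix (Fin nz) (Fin nz) ℝ} (hP₁ : P₁ᵀ = P₁)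
    {P₂ : Matrix (Fin ny) (Fin ny) ℝ} (hP₂ : P₂ᵀ = P₂) (δ χ : ℝ)
    (L : Matrix (Fin nz) (Fin ny) ℝ) (H : Matrix (Fin ny) (Fin ny) ℝ) (τ : ℝ) (ε : Vec (Fin nz))
    (θ : Vec (Fin ny)) (ζ : Vec (Fin ns)) :
    inner ℝ (Vec.stack ε (Vec.stack θ ζ))
        (mulV (P.calMred lamt ell P₁ P₂ δ χ L H τ) (Vec.stack ε (Vec.stack θ ζ))) =
      P.formOne lamt ell χ P₁ L ε θ ζ +
        Real.exp (δ * τ) * P.formTwo lamt δ P₂ L H ε θ ζ := by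
  have hblock : P.calMred lamt ell P₁ P₂ δ χ L H τ =
      Matrix.fromBlocks
        (He (P₁ * (P.A - L * P.C)) + (2 * lamt) • P₁ + P.Cpᵀ * P.Cp +
          (χ * ell ^ 2) • (P.Sᵀ * P.S))
        (Matrix.fromCols (P₁ * L + Real.exp (δ * τ) •
          ((P.C * P.A - P.C * L * P.C - H * P.C)ᵀ * P₂)) (P₁ * P.B))
        (Matrix.fromCols (P₁ * L + Real.exp (δ * τ) •
          ((P.C * P.A - P.C * L * P.C - H * P.C)ᵀ * P₂)) (P₁ * P.B))ᵀ
        (Matrix.fromBlocks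
          (Real.exp (δ * τ) • (He (P₂ * (P.C * L + H)) + (2 * lamt - δ) • P₂))
          (Real.exp (δ * τ) • (P₂ * P.C * P.B)) (Real.exp (δ * τ) • (P₂ * P.C * P.B))ᵀ
          ((-χ) • (1 : Matrix (Fin ns) (Fin ns) ℝ))) := by
    ext i j
    rcases i with i | i | i <;> rcases j with j | j | j <;> rfl
  have hHe : ∀ {n : ℕ} (M : Matrix (Fin n) (Fin n) ℝ) (x : Vec (Fin n)),
      inner ℝ x (mulV (He M) x) = 2 * inner ℝ x (mulV M x) := by
    intro n M x
    rw [He, mulV_add_matrix, inner_add_right, inner_mulV_transpose, real_inner_comm x]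
    ring
  rw [hblock, inner_fromBlocks, inner_fromBlocks, mulV_fromCols]
  simp only [mulV_add_matrix, mulV_smul_matrix, inner_add_right, inner_smul_right, hHe, mulV_mul,
    inner_mulV_transpose, mulV_one, inner_mulV_comm hP₁ ε, inner_mulV_comm hP₂ θ,
    real_inner_self_eq_norm_sq, formOne, formTwo]
  rw [real_inner_comm (mulV P₂ θ) (mulV (P.C * P.A - P.C * L * P.C - H * P.C) ε)]
  ring

/-- The matrix inequality at the two end points gives a uniform bound in between. -/
theorem exists_form_le {lamt ell : ℝ} {P₁ : Matrix (Fin nz) (Fin nz) ℝ} (hP₁ : P₁ᵀ = P₁)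
    {P₂ : Matrix (Fin ny) (Fin ny) ℝ} (hP₂ : P₂ᵀ = P₂) {δ χ : ℝ} (hδ : 0 < δ)
    {L : Matrix (Fin nz) (Fin ny) ℝ} {H : Matrix (Fin ny) (Fin ny) ℝ} {T₂ : ℝ}
    (hM₀ : (-P.calMred lamt ell P₁ P₂ δ χ L H 0).PosDef)
    (hMT : (-P.calMred lamt ell P₁ P₂ δ χ L H T₂).PosDef) :
    ∃ m > (0 : ℝ), ∀ τ ∈ Icc 0 T₂, ∀ ε θ ζ,
      P.formOne lamt ell χ P₁ L ε θ ζ + Real.exp (δ * τ) * P.formTwo lamt δ P₂ L H ε θ ζ ≤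
        -m * (‖ε‖ ^ 2 + ‖θ‖ ^ 2) := by
  obtain ⟨c₀, hc₀, h₀⟩ := exists_pos_mul_norm_sq_le hM₀
  obtain ⟨c₁, hc₁, h₁⟩ := exists_pos_mul_norm_sq_le hMT
  refine ⟨min c₀ c₁, lt_min hc₀ hc₁, fun τ hτ ε θ ζ => ?_⟩
  have hneg : ∀ (M : Matrix (Fin nz ⊕ (Fin ny ⊕ Fin ns)) (Fin nz ⊕ (Fin ny ⊕ Fin ns)) ℝ) x,
      inner ℝ x (mulV (-M) x) = -inner ℝ x (mulV M x) := by
    intro M x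
    rw [← neg_one_smul ℝ M, mulV_smul_matrix, inner_smul_right]
    ring
  have k₀ := h₀ (Vec.stack ε (Vec.stack θ ζ))
  have k₁ := h₁ (Vec.stack ε (Vec.stack θ ζ))
  rw [hneg, inner_mulV_calMred P lamt ell hP₁ hP₂, norm_stack_sq, norm_stack_sq] at k₀ k₁
  rw [mul_zero, Real.exp_zero] at k₀
  set a := P.formOne lamt ell χ P₁ L ε θ ζ
  set b := P.formTwo lamt δ P₂ L H ε θ ζ
  set n := ‖ε‖ ^ 2 + ‖θ‖ ^ 2 with hn
  have hn0 : 0 ≤ n := by positivity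
  -- The part of the margin that belongs to `ζ` is given away; only `ε` and `θ̃` are needed to
  -- absorb `w`.
  have m₀ : min c₀ c₁ * n ≤ c₀ * (‖ε‖ ^ 2 + (‖θ‖ ^ 2 + ‖ζ‖ ^ 2)) := by
    have : n ≤ ‖ε‖ ^ 2 + (‖θ‖ ^ 2 + ‖ζ‖ ^ 2) := by rw [hn]; nlinarith [sq_nonneg ‖ζ‖]
    gcongr
    exact min_le_left _ _
  have m₁ : min c₀ c₁ * n ≤ c₁ * (‖ε‖ ^ 2 + (‖θ‖ ^ 2 + ‖ζ‖ ^ 2)) := by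
    have : n ≤ ‖ε‖ ^ 2 + (‖θ‖ ^ 2 + ‖ζ‖ ^ 2) := by rw [hn]; nlinarith [sq_nonneg ‖ζ‖]
    gcongr
    exact min_le_right _ _
  have e₁ : 1 ≤ Real.exp (δ * τ) := Real.one_le_exp (mul_nonneg hδ.le hτ.1)
  have e₂ : Real.exp (δ * τ) ≤ Real.exp (δ * T₂) := by
    gcongr
    exact hτ.2
  -- `a + e^{δτ} b` is monotone in `e^{δτ}`: for `b ≥ 0` it is largest at `τ = T₂`, for `b ≤ 0` at
  -- `τ = 0`.
  rcases le_total 0 b with hb | hb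
  · nlinarith [mul_le_mul_of_nonneg_right e₂ hb]
  · nlinarith [mul_le_mul_of_nonpos_right e₁ hb]

/-! ### The storage function -/

/-- The storage function `εᵀ P₁ ε + e^{δτ} θ̃ᵀ P₂ θ̃`. -/
noncomputable def storage (P₁ : Matrix (Fin nz) (Fin nz) ℝ) (P₂ : Matrix (Fin ny) (Fin ny) ℝ)
    (δ : ℝ) (x : Vec (StateIdx nz ny)) : ℝ :=
  inner ℝ (epsPart x) (mulV P₁ (epsPart x)) +
    Real.exp (δ * timer x) * inner ℝ (thetaPart x) (mulV P₂ (thetaPart x))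

/-- The derivative of the storage function in the direction `v` if `v` has timer component `-1`. -/
noncomputable def storageDeriv (P₁ : Matrix (Fin nz) (Fin nz) ℝ) (P₂ : Matrix (Fin ny) (Fin ny) ℝ)
    (δ : ℝ) (x v : Vec (StateIdx nz ny)) : ℝ :=
  2 * inner ℝ (mulV P₁ (epsPart x)) (epsPart v) +
    Real.exp (δ * timer x) * (2 * inner ℝ (mulV P₂ (thetaPart x)) (thetaPart v) -
      δ * inner ℝ (thetaPart x) (mulV P₂ (thetaPart x)))

theorem contDiff_storage (P₁ : Matrix (Fin nz) (Fin nz) ℝ) (P₂ : Matrix (Fin ny) (Fin ny) ℝ)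
    (δ : ℝ) : ContDiff ℝ 1 (storage P₁ P₂ δ) := by
  have hε := (epsL nz ny).contDiff (n := 1)
  have hθ := (thetaL nz ny).contDiff (n := 1)
  have hτ := (timerL nz ny).contDiff (n := 1)
  exact (hε.inner ℝ ((mulVL P₁).contDiff.comp hε)).add
    ((Real.contDiff_exp.comp (contDiff_const.mul hτ)).mul
      (hθ.inner ℝ ((mulVL P₂).contDiff.comp hθ)))

theorem hasDerivAt_storage {P₁ : Matrix (Fin nz) (Fin nz) ℝ} (hP₁ : P₁ᵀ = P₁)
    {P₂ : Matrix (Fin ny) (Fin ny) ℝ} (hP₂ : P₂ᵀ = P₂) (δ : ℝ) {f : ℝ → Vec (StateIdx nz ny)}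
    {v : Vec (StateIdx nz ny)} {t : ℝ} (hf : HasDerivAt f v t) (hv : timer v = -1) :
    HasDerivAt (fun s => storage P₁ P₂ δ (f s)) (storageDeriv P₁ P₂ δ (f t) v) t := by
  have hε := (epsL nz ny).hasFDerivAt.comp_hasDerivAt t hf
  have hθ := (thetaL nz ny).hasFDerivAt.comp_hasDerivAt t hf
  have hτ := (timerL nz ny).hasFDerivAt.comp_hasDerivAt t hf
  have hε' := (mulVL P₁).hasFDerivAt.comp_hasDerivAt t hε
  have hθ' := (mulVL P₂).hasFDerivAt.comp_hasDerivAt t hθ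
  have h : HasDerivAt (fun s => storage P₁ P₂ δ (f s)) _ t :=
    (hε.inner ℝ hε').add (((hτ.const_mul δ).exp).mul (hθ.inner ℝ hθ'))
  refine h.congr_deriv ?_
  have a₁ : inner ℝ (mulV P₁ (epsPart v)) (epsPart (f t)) =
      inner ℝ (mulV P₁ (epsPart (f t))) (epsPart v) := by
    rw [← inner_mulV_comm hP₁, real_inner_comm]
  have a₂ : inner ℝ (mulV P₂ (thetaPart v)) (thetaPart (f t)) =
      inner ℝ (mulV P₂ (thetaPart (f t))) (thetaPart v) := by
    rw [← inner_mulV_comm hP₂, real_inner_comm]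
  simp only [Function.comp, epsL_apply, thetaL_apply, timerL_apply, mulVL_apply, hv, storageDeriv,
    inner_mulV_comm hP₁, inner_mulV_comm hP₂, a₁, a₂]
  ring

theorem epsPart_flowMap (L : Matrix (Fin nz) (Fin ny) ℝ) (H : Matrix (Fin ny) (Fin ny) ℝ)
    (T₁ T₂ : ℝ) (x : Vec (StateIdx nz ny)) (w : Vec (Fin nw)) :
    epsPart ((P.errorSystem L H T₁ T₂).flowMap x w) =
      mulV (P.A - L * P.C) (epsPart x) + mulV L (thetaPart x) +
        mulV P.B (P.zeta (zPart x) (epsPart x)) + mulV P.N w := by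
  change (mulV (P.calF L H) (errPart x)).first + (mulV P.calQ _).first + (mulV P.calT w).first = _
  rw [calF, calQ, calT, mulV_fromBlocks, mulV_fromRows, mulV_fromRows]
  rfl

theorem thetaPart_flowMap (L : Matrix (Fin nz) (Fin ny) ℝ) (H : Matrix (Fin ny) (Fin ny) ℝ)
    (T₁ T₂ : ℝ) (x : Vec (StateIdx nz ny)) (w : Vec (Fin nw)) :
    thetaPart ((P.errorSystem L H T₁ T₂).flowMap x w) =
      mulV (P.C * P.A - P.C * L * P.C - H * P.C) (epsPart x) + mulV (P.C * L + H) (thetaPart x) +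
        mulV P.C (mulV P.B (P.zeta (zPart x) (epsPart x))) + mulV P.C (mulV P.N w) := by
  rw [← mulV_mul, ← mulV_mul]
  change (mulV (P.calF L H) (errPart x)).second + (mulV P.calQ _).second +
    (mulV P.calT w).second = _
  rw [calF, calQ, calT, mulV_fromBlocks, mulV_fromRows, mulV_fromRows]
  rfl

/-- The dissipation inequality along flows. -/
theorem exists_storageDeriv_le {lamt ell : ℝ}
    (hψ : ∀ v₁ v₂, ‖P.ψ v₁ - P.ψ v₂‖ ≤ ell * ‖v₁ - v₂‖)
    {P₁ : Matrix (Fin nz) (Fin nz) ℝ} (hP₁ : P₁ᵀ = P₁)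
    {P₂ : Matrix (Fin ny) (Fin ny) ℝ} (hP₂ : P₂ᵀ = P₂) {δ χ : ℝ} (hδ : 0 < δ) (hχ : 0 < χ)
    {L : Matrix (Fin nz) (Fin ny) ℝ} {H : Matrix (Fin ny) (Fin ny) ℝ} {T₂ : ℝ} (T₁ : ℝ)
    (hM₀ : (-P.calMred lamt ell P₁ P₂ δ χ L H 0).PosDef)
    (hMT : (-P.calMred lamt ell P₁ P₂ δ χ L H T₂).PosDef) :
    ∃ γ > (0 : ℝ), ∀ x w, timer x ∈ Icc 0 T₂ →
      storageDeriv P₁ P₂ δ x ((P.errorSystem L H T₁ T₂).flowMap x w) ≤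
        -(2 * lamt) * storage P₁ P₂ δ x - ‖P.perfOutput x‖ ^ 2 + γ ^ 2 * ‖w‖ ^ 2 := by
  obtain ⟨m, hm, hform⟩ := P.exists_form_le hP₁ hP₂ hδ hM₀ hMT
  set c₁ := ‖mulVL P₁‖ * ‖mulVL P.N‖ with hc₁
  set c₂ := Real.exp (δ * T₂) * (‖mulVL P₂‖ * (‖mulVL P.C‖ * ‖mulVL P.N‖)) with hc₂
  have hc₁0 : 0 ≤ c₁ := by positivity
  have hc₂0 : 0 ≤ c₂ := by positivity
  -- `c₁² / m` and `c₂² / m` are the costs of Young's inequality for the cross terms of `w` with `ε`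
  -- and `θ̃`. The summand `1` makes `γ` positive.
  refine ⟨√((c₁ ^ 2 + c₂ ^ 2) / m + 1), by positivity, fun x w hx => ?_⟩
  rw [Real.sq_sqrt (by positivity)]
  set ε := epsPart x with hε
  set θ := thetaPart x with hθ
  set ζ := P.zeta (zPart x) ε with hζ
  have hf := hform (timer x) hx ε θ ζ
  have hout : P.perfOutput x = mulV P.Cp ε := rfl
  -- The S-procedure: the multiplier term `χ(ℓ²‖Sε‖² - ‖ζ‖²)` in the form is nonnegative at the
  -- actual `ζ`, so it can be discarded.
  have hζle : χ * ‖ζ‖ ^ 2 ≤ χ * ell ^ 2 * ‖mulV P.S ε‖ ^ 2 := by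
    have := P.norm_zeta_le hψ (zPart x) ε
    calc χ * ‖ζ‖ ^ 2 ≤ χ * (ell * ‖mulV P.S ε‖) ^ 2 := by gcongr
      _ = _ := by ring
  have hw₁ : inner ℝ (mulV P₁ ε) (mulV P.N w) ≤ c₁ * (‖ε‖ * ‖w‖) := by
    refine (real_inner_le_norm _ _).trans ?_
    calc _ ≤ (‖mulVL P₁‖ * ‖ε‖) * (‖mulVL P.N‖ * ‖w‖) := by
          gcongr <;> exact norm_mulV_le _ _
      _ = _ := by rw [hc₁]; ring
  have hw₂ : Real.exp (δ * timer x) * inner ℝ (mulV P₂ θ) (mulV P.C (mulV P.N w)) ≤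
      c₂ * (‖θ‖ * ‖w‖) := by
    calc _ ≤ Real.exp (δ * timer x) * (‖mulV P₂ θ‖ * ‖mulV P.C (mulV P.N w)‖) := by
          gcongr
          exact real_inner_le_norm _ _
      _ ≤ Real.exp (δ * T₂) * ((‖mulVL P₂‖ * ‖θ‖) * (‖mulVL P.C‖ * (‖mulVL P.N‖ * ‖w‖))) := by
          gcongr
          · exact hx.2
          · exact norm_mulV_le _ _
          · refine (norm_mulV_le _ _).trans ?_
            gcongr
            exact norm_mulV_le _ _
      _ = _ := by rw [hc₂]; ring
  have young : ∀ c a b : ℝ, 2 * (c * (a * b)) ≤ m * a ^ 2 + c ^ 2 / m * b ^ 2 := by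
    intro c a b
    have : m * a ^ 2 + c ^ 2 / m * b ^ 2 - 2 * (c * (a * b)) = (m * a - c * b) ^ 2 / m := by
      field_simp
      ring
    have : 0 ≤ (m * a - c * b) ^ 2 / m := by positivity
    linarith
  have y₁ := young c₁ ‖ε‖ ‖w‖
  have y₂ := young c₂ ‖θ‖ ‖w‖
  rw [storageDeriv, epsPart_flowMap, thetaPart_flowMap, storage, hout, ← hε, ← hθ, ← hζ,
    inner_add_right _ _ (mulV P.N w), inner_add_right _ _ (mulV P.C (mulV P.N w))]
  simp only [formOne, formTwo] at hf
  have hfin : ((c₁ ^ 2 + c₂ ^ 2) / m + 1) * ‖w‖ ^ 2 =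
      c₁ ^ 2 / m * ‖w‖ ^ 2 + c₂ ^ 2 / m * ‖w‖ ^ 2 + ‖w‖ ^ 2 := by ring
  rw [hfin]
  linarith [sq_nonneg ‖w‖]

theorem exists_storage_bounds {P₁ : Matrix (Fin nz) (Fin nz) ℝ} (hP₁ : P₁.PosDef)
    {P₂ : Matrix (Fin ny) (Fin ny) ℝ} (hP₂ : P₂.PosDef) {δ : ℝ} (hδ : 0 < δ) (T₂ : ℝ) :
    ∃ c₁ > (0 : ℝ), ∃ c₂ > (0 : ℝ), ∀ x, timer x ∈ Icc 0 T₂ →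
      c₁ * ‖errPart x‖ ^ 2 ≤ storage P₁ P₂ δ x ∧ storage P₁ P₂ δ x ≤ c₂ * ‖errPart x‖ ^ 2 := by
  obtain ⟨a, ha, h₁⟩ := exists_pos_mul_norm_sq_le hP₁
  obtain ⟨b, hb, h₂⟩ := exists_pos_mul_norm_sq_le hP₂
  -- The weight lies between `1` and `e^{δT₂}`. The added `1` keeps the upper constant positive when
  -- both dimensions are zero.
  refine ⟨min a b, lt_min ha hb, ‖mulVL P₁‖ + Real.exp (δ * T₂) * ‖mulVL P₂‖ + 1, by positivity,
    fun x hx => ?_⟩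
  have e₁ : 1 ≤ Real.exp (δ * timer x) := Real.one_le_exp (mul_nonneg hδ.le hx.1)
  have e₂ : Real.exp (δ * timer x) ≤ Real.exp (δ * T₂) := by
    gcongr
    exact hx.2
  rw [norm_errPart_sq, storage]
  set ε := epsPart x
  set θ := thetaPart x
  constructor
  · have k₁ : min a b * ‖ε‖ ^ 2 ≤ inner ℝ ε (mulV P₁ ε) :=
      (mul_le_mul_of_nonneg_right (min_le_left _ _) (sq_nonneg _)).trans (h₁ ε)
    have k₂ : min a b * ‖θ‖ ^ 2 ≤ inner ℝ θ (mulV P₂ θ) :=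
      (mul_le_mul_of_nonneg_right (min_le_right _ _) (sq_nonneg _)).trans (h₂ θ)
    have k₃ : 0 ≤ inner ℝ θ (mulV P₂ θ) := le_trans (by positivity) (h₂ θ)
    nlinarith [mul_le_mul_of_nonneg_right e₁ k₃]
  · have k₁ := inner_mulV_self_le P₁ ε
    have k₂ : Real.exp (δ * timer x) * inner ℝ θ (mulV P₂ θ) ≤
        Real.exp (δ * T₂) * (‖mulVL P₂‖ * ‖θ‖ ^ 2) :=
      (mul_le_mul_of_nonneg_left (inner_mulV_self_le P₂ θ) (Real.exp_pos _).le).trans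
        (mul_le_mul_of_nonneg_right e₂ (by positivity))
    have d₁ : 0 ≤ ‖mulVL P₁‖ * ‖θ‖ ^ 2 := by positivity
    have d₂ : 0 ≤ Real.exp (δ * T₂) * ‖mulVL P₂‖ * ‖ε‖ ^ 2 := by positivity
    nlinarith [sq_nonneg ‖ε‖, sq_nonneg ‖θ‖]

end Plant

/-! ### Elementary properties of solution pairs -/

namespace Plant

variable {nz ny nw nq ns np : ℕ} {P : Plant nz ny nw nq ns np}
  {L : Matrix (Fin nz) (Fin ny) ℝ} {H : Matrix (Fin ny) (Fin ny) ℝ} {T₁ T₂ : ℝ}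
  {φ : HybridSignal (Vec (StateIdx nz ny))} {u : HybridSignal (Vec (Fin nw ⊕ Fin ny))}
  {t : ℕ → ℝ}

theorem timer_eq (hS : (P.errorSystem L H T₁ T₂).IsSolutionPair φ u) (ht : IsStartTimes φ.dom t)
    {s : ℝ} {j : ℕ} (h : (s, j) ∈ φ.dom) :
    timer (φ.val s j) = timer (φ.val (t j) j) - (s - t j) := by
  have hsub := ht.Icc_subset_slice h
  have hac := absolutelyContinuousOnInterval_comp_contDiff (timerL nz ny).contDiff
    (hS.arc j _ _ (ht.start_le h) hsub)
  have := eq_add_mul_of_ae_hasDerivAt_const (c := -1) (ht.start_le h) hac ?_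
  · simp only [timerL_apply] at this
    linarith
  · filter_upwards [ae_restrict_of_ae_restrict_of_subset hsub (hS.flow_deriv j)] with r hr
    exact (timerL nz ny).hasFDerivAt.comp_hasDerivAt r hr

theorem mem_jumpSet (ht : IsStartTimes φ.dom t) {s : ℝ} {j : ℕ} (h : (s, j + 1) ∈ φ.dom) :
    (t (j + 1), j) ∈ φ.jumpSet := ⟨ht.end_mem h, ht.start_mem h⟩

theorem timer_start_mem (hS : (P.errorSystem L H T₁ T₂).IsSolutionPair φ u)
    (ht : IsStartTimes φ.dom t) {s : ℝ} {j : ℕ} (h : (s, j + 1) ∈ φ.dom) :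
    timer (φ.val (t (j + 1)) (j + 1)) ∈ Icc T₁ T₂ := by
  obtain ⟨v, hv, hG⟩ := (hS.jump _ (mem_jumpSet ht h)).2
  simp only at hG
  rw [hG]
  exact hv

theorem timer_mem (hS : (P.errorSystem L H T₁ T₂).IsSolutionPair φ u)
    (ht : IsStartTimes φ.dom t) (hT₁ : 0 < T₁) (hT₂ : T₁ ≤ T₂) {s : ℝ} {j : ℕ}
    (h : (s, j) ∈ φ.dom) : timer (φ.val s j) ∈ Icc 0 T₂ := by
  have hstart : timer (φ.val (t j) j) ∈ Icc 0 T₂ := by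
    rcases j with _ | j
    · rw [ht.zero]
      rcases hS.init with h0 | h0
      · have hcl : IsClosed (P.errorSystem L H T₁ T₂).flowSet :=
          isClosed_Icc.preimage (timerL nz ny).continuous
        rwa [hcl.closure_eq] at h0
      · have h0 : timer (φ.val 0 0) = 0 := h0
        rw [h0]
        exact ⟨le_rfl, hT₁.le.trans hT₂⟩
    · have := timer_start_mem hS ht h
      exact ⟨hT₁.le.trans this.1, this.2⟩
  have hle := ht.start_le h
  rw [timer_eq hS ht h]
  refine ⟨?_, by linarith [hstart.2]⟩
  rcases eq_or_lt_of_le hle with heq | hlt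
  · rw [← heq, sub_self, sub_zero]
    exact hstart.1
  · rw [sub_nonneg]
    -- The flow set is only known to contain the interior of a flow interval, so the right end is
    -- reached as the limit of `r < s`.
    refine sub_le_iff_le_add.2 (le_of_forall_lt_imp_le_of_dense fun r hr => ?_)
    rcases le_total r (t j) with hr' | hr'
    · linarith [hstart.1]
    rcases eq_or_lt_of_le hr' with rfl | hr'
    · linarith [hstart.1]
    have hint : r ∈ interior (φ.slice j) :=
      interior_mono (ht.Icc_subset_slice h) (by rw [interior_Icc]; exact ⟨hr', hr⟩)
    have := (hS.flow_mem j r hint : timer (φ.val r j) ∈ Icc 0 T₂).1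
    rw [timer_eq hS ht (interior_subset hint : r ∈ φ.slice j)] at this
    linarith

/-- A jump resets the timer to at least `T₁`, and it must run down to zero before the next one. The
interval of index `0` is excluded, because the initial timer may be arbitrarily small. -/
theorem start_spacing (hS : (P.errorSystem L H T₁ T₂).IsSolutionPair φ u)
    (ht : IsStartTimes φ.dom t) {s : ℝ} {j : ℕ} (h : (s, j + 2) ∈ φ.dom) :
    T₁ ≤ t (j + 2) - t (j + 1) := by
  have h1 := ht.end_mem h
  have h2 := (hS.jump _ (mem_jumpSet ht h)).1
  have h3 : timer (φ.val (t (j + 2)) (j + 1)) = 0 := h2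
  rw [timer_eq hS ht h1] at h3
  linarith [(timer_start_mem hS ht h1).1]

/-- Only the first jump can come sooner than `T₁` after the preceding start time, which costs the
summand `T₁`. -/
theorem mul_index_le (hT₁ : 0 < T₁) (hS : (P.errorSystem L H T₁ T₂).IsSolutionPair φ u)
    (ht : IsStartTimes φ.dom t) {s : ℝ} {j : ℕ} (h : (s, j) ∈ φ.dom) :
    T₁ * j ≤ s + T₁ := by
  rcases j with _ | j
  · have := ht.nonneg h
    push_cast
    linarith
  have key : ∀ i : ℕ, i ≤ j → T₁ * i ≤ t (i + 1) := by
    intro i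
    induction i with
    | zero =>
      intro _
      have := ht.mono (Nat.zero_le 1)
      rw [ht.zero] at this
      simpa using this
    | succ i ih =>
      intro hi
      have h1 := ih (by omega)
      have h2 := start_spacing hS ht (ht.mem_of_index_le (by omega : i + 2 ≤ j + 1) h)
      push_cast
      linarith
  have h1 := key j le_rfl
  have h2 := ht.start_le h
  push_cast
  linarith

/-- The jump keeps `ε`. The old `θ̃` term is nonnegative and is dropped; the new one is quadratic in
`η`, with the new timer at most `T₂`. -/
theorem storage_jump_le (hS : (P.errorSystem L H T₁ T₂).IsSolutionPair φ u)
    (ht : IsStartTimes φ.dom t) {P₁ : Matrix (Fin nz) (Fin nz) ℝ}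
    {P₂ : Matrix (Fin ny) (Fin ny) ℝ} (hP₂ : P₂.PosDef) {δ : ℝ} (hδ : 0 < δ) {s : ℝ} {j : ℕ}
    (h : (s, j + 1) ∈ φ.dom) :
    storage P₁ P₂ δ (φ.val (t (j + 1)) (j + 1)) ≤ storage P₁ P₂ δ (φ.val (t (j + 1)) j) +
      Real.exp (δ * T₂) * ‖mulVL P₂‖ * ‖(u.val (t (j + 1)) j).second‖ ^ 2 := by
  obtain ⟨h0, v, hv, hG⟩ := hS.jump _ (mem_jumpSet ht h)
  simp only at hG
  set x := φ.val (t (j + 1)) j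
  set η := (u.val (t (j + 1)) j).second
  obtain ⟨c, hc, hcoer⟩ := exists_pos_mul_norm_sq_le hP₂
  have h1 : epsPart (φ.val (t (j + 1)) (j + 1)) = epsPart x := by
    rw [hG, epsPart, errPart_mkState, calG, calN, mulV_fromBlocks, mulV_fromRows]
    change mulV 1 (epsPart x) + mulV 0 (thetaPart x) + mulV 0 η = _
    ext i
    simp [mulV]
  have h2 : thetaPart (φ.val (t (j + 1)) (j + 1)) = -η := by
    rw [hG, thetaPart, errPart_mkState, calG, calN, mulV_fromBlocks, mulV_fromRows]
    change mulV 0 (epsPart x) + mulV 0 (thetaPart x) + mulV (-1) η = _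
    ext i
    simp [mulV, Matrix.neg_mulVec]
  have h3 : timer (φ.val (t (j + 1)) (j + 1)) = v := by
    rw [hG]
    rfl
  rw [storage, storage, h1, h2, h3]
  have h4 : 0 ≤ Real.exp (δ * timer x) * inner ℝ (thetaPart x) (mulV P₂ (thetaPart x)) :=
    mul_nonneg (Real.exp_pos _).le (le_trans (by positivity) (hcoer _))
  have h5 : Real.exp (δ * v) * inner ℝ (-η) (mulV P₂ (-η)) ≤
      Real.exp (δ * T₂) * ‖mulVL P₂‖ * ‖η‖ ^ 2 := by
    have e : Real.exp (δ * v) ≤ Real.exp (δ * T₂) := by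
      gcongr
      exact hv.2
    have := inner_mulV_self_le P₂ (-η)
    rw [norm_neg] at this
    calc _ ≤ Real.exp (δ * v) * (‖mulVL P₂‖ * ‖η‖ ^ 2) := by gcongr
      _ ≤ Real.exp (δ * T₂) * (‖mulVL P₂‖ * ‖η‖ ^ 2) := by gcongr
      _ = _ := by ring
  linarith

theorem ae_hasDerivAt_storage (hS : (P.errorSystem L H T₁ T₂).IsSolutionPair φ u)
    {P₁ : Matrix (Fin nz) (Fin nz) ℝ} (hP₁ : P₁ᵀ = P₁)
    {P₂ : Matrix (Fin ny) (Fin ny) ℝ} (hP₂ : P₂ᵀ = P₂) (δ : ℝ) (j : ℕ) :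
    ∀ᵐ s ∂(volume.restrict (φ.slice j)),
      HasDerivAt (fun s => storage P₁ P₂ δ (φ.val s j)) (storageDeriv P₁ P₂ δ (φ.val s j)
        ((P.errorSystem L H T₁ T₂).flowMap (φ.val s j) (u.val s j).first)) s := by
  filter_upwards [hS.flow_deriv j] with s hs
  exact hasDerivAt_storage hP₁ hP₂ δ hs (P.timer_flowMap L H T₁ T₂ _ _)

end Plant

/-! ### Essential bounds of inputs -/

theorem HybridSignal.ae_norm_le_linfty {ι V : Type} [Fintype ι] {φ : HybridSignal V}
    {u : HybridSignal (Vec ι)} {t : ℕ → ℝ} (ht : IsStartTimes φ.dom t) (hdom : φ.dom = u.dom)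
    (hu : u.linfty < ⊤) (j : ℕ) :
    ∀ᵐ s ∂(volume.restrict (φ.slice j)), ‖u.val s j‖ ≤ u.linfty.toReal := by
  set A : ℕ → Set ℝ := fun n => {s | (s, j) ∈ u.dom \ u.jumpSet ∧ s + j ≤ n}
  have hA : ∀ n, ∀ᵐ s ∂(volume.restrict (A n)), ‖u.val s j‖ ≤ u.linfty.toReal := by
    intro n
    have h1 : ∀ᵐ s ∂(volume.restrict (A n)), ‖u.val s j‖ₑ ≤
        essSup (fun s => ‖u.val s j‖ₑ) (volume.restrict (A n)) := ENNReal.ae_le_essSup _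
    filter_upwards [h1] with s hs
    have h2 : ‖u.val s j‖ₑ ≤ u.linfty := by
      refine hs.trans ?_
      refine le_trans ?_ (le_iSup (fun T : ℝ => u.linftyTrunc T) n)
      exact (le_iSup (fun k : ℕ => essSup (fun s => ‖u.val s k‖ₑ)
        (volume.restrict {s | (s, k) ∈ u.dom \ u.jumpSet ∧ s + k ≤ (n : ℝ)})) j).trans
          (le_max_left _ _)
    have := ENNReal.toReal_mono hu.ne h2
    simpa using this
  have hU := (ae_restrict_iUnion_iff A _).2 hA
  -- The essential supremum ignores jump times, but a slice contains at most one of them, its right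
  -- end, which is a null set.
  have hsub : φ.slice j ⊆ (⋃ n, A n) ∪ {t (j + 1)} := by
    intro s hs
    have hs' : (s, j) ∈ φ.dom := hs
    by_cases hj : (s, j) ∈ u.jumpSet
    · right
      have h1 : (s, j + 1) ∈ φ.dom := hdom ▸ hj.2
      exact le_antisymm (ht.le_end hs' h1) (ht.start_le h1)
    · left
      obtain ⟨n, hn⟩ := exists_nat_ge (s + j)
      exact mem_iUnion.2 ⟨n, ⟨hdom ▸ hs', hj⟩, hn⟩
  refine ae_restrict_of_ae_restrict_of_subset hsub ?_
  rw [ae_restrict_union_iff]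
  refine ⟨hU, ?_⟩
  rw [Measure.restrict_singleton]
  simp

theorem HybridSignal.norm_le_linfty_of_mem_jumpSet {ι : Type} [Fintype ι]
    {u : HybridSignal (Vec ι)} (hu : u.linfty < ⊤) {s : ℝ} {j : ℕ} (h : (s, j) ∈ u.jumpSet) :
    ‖u.val s j‖ ≤ u.linfty.toReal := by
  have h2 : ‖u.val s j‖ₑ ≤ u.linfty := by
    refine le_trans ?_ (le_iSup (fun T : ℝ => u.linftyTrunc T) (s + j))
    refine le_trans ?_ (le_max_right _ _)
    exact le_iSup₂ (f := fun (q : ℝ × ℕ)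
      (_ : q ∈ {q : ℝ × ℕ | q ∈ u.jumpSet ∧ q.1 + q.2 ≤ s + j}) => ‖u.val q.1 q.2‖ₑ) (s, j)
      ⟨h, le_rfl⟩
  have := ENNReal.toReal_mono hu.ne h2
  simpa using this

/-! ### Completeness of maximal solution pairs -/

theorem HybridSignal.slice_eq_of_dom_eq {V : Type} {φ : HybridSignal V} {t : ℕ → ℝ} {J : ℕ}
    {last : Set ℝ} (hdom : φ.dom = cutDomain t J last) : φ.slice J = last := by
  ext s
  change (s, J) ∈ φ.dom ↔ _
  rw [hdom, mem_cutDomain_self]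

namespace HybridSystem

variable {ι κ μ : Type} [Fintype ι] [Fintype κ] {S : HybridSystem ι κ μ} {K : ℝ}
  {φ : HybridSignal (Vec ι)} {u : HybridSignal (Vec (κ ⊕ μ))}

theorem norm_flowMap_le
    (hLip : ∀ x y w w', ‖S.flowMap x w - S.flowMap y w'‖ ≤ K * (‖x - y‖ + ‖w - w'‖))
    (x : Vec ι) (w : Vec κ) : ‖S.flowMap x w‖ ≤ ‖S.flowMap 0 0‖ + K * (‖x‖ + ‖w‖) := by
  have h1 := hLip x 0 w 0
  rw [sub_zero, sub_zero] at h1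
  have h2 := norm_sub_norm_le (S.flowMap x w) (S.flowMap 0 0)
  linarith

/-- Local solutions of the flow with zero input. -/
theorem exists_local_flow (hK : 0 ≤ K)
    (hLip : ∀ x y w w', ‖S.flowMap x w - S.flowMap y w'‖ ≤ K * (‖x - y‖ + ‖w - w'‖))
    (x₀ : Vec ι) (T : ℝ) {e : ℝ} (he : 0 < e) :
    ∃ b, T < b ∧ b ≤ T + e ∧ ∃ f : ℝ → Vec ι, f T = x₀ ∧
      AbsolutelyContinuousOnInterval f T b ∧
      ∀ s ∈ Ioo T b, HasDerivAt f (S.flowMap (f s) 0) s := by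
  set F : Vec ι → Vec ι := fun x => S.flowMap x 0
  have hF : ∀ x y, ‖F x - F y‖ ≤ K * ‖x - y‖ := fun x y => by simpa using hLip x y 0 0
  have hFL : LipschitzWith ⟨K, hK⟩ F := LipschitzWith.of_dist_le_mul fun x y => by
    rw [dist_eq_norm, dist_eq_norm]
    exact hF x y
  -- `B` bounds `F` on the unit ball around `x₀`. A duration `d` with `B d ≤ 1` keeps the solution
  -- in that ball.
  set B : NNReal := ⟨‖F x₀‖ + K, by positivity⟩ with hB
  set d := min e (1 / ((B : ℝ) + 1)) with hd
  have hd0 : 0 < d := lt_min he (by positivity)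
  have hPL : IsPicardLindelof (fun _ => F) (tmin := T) (tmax := T + d)
      ⟨T, le_rfl, by linarith⟩ x₀ 1 0 B ⟨K, hK⟩ := by
    refine IsPicardLindelof.of_time_independent ?_ hFL.lipschitzOnWith ?_
    · intro x hx
      have h1 : ‖x - x₀‖ ≤ 1 := by simpa [dist_eq_norm] using hx
      have h2 := norm_sub_norm_le (F x) (F x₀)
      have h3 := hF x x₀
      have h4 : K * ‖x - x₀‖ ≤ K * 1 := by gcongr
      change ‖F x‖ ≤ ‖F x₀‖ + K
      linarith
    · have h1 : d ≤ 1 / ((B : ℝ) + 1) := min_le_right _ _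
      rw [le_div_iff₀ (by positivity)] at h1
      simp only [add_sub_cancel_left, sub_self, NNReal.coe_one, NNReal.coe_zero, sub_zero]
      rw [max_eq_left hd0.le]
      linarith
  obtain ⟨f, hf0, hf⟩ := hPL.exists_eq_forall_mem_Icc_hasDerivWithinAt₀
  have hcont : ContinuousOn f (Icc T (T + d)) := HasDerivWithinAt.continuousOn hf
  obtain ⟨M, hM⟩ := isCompact_Icc.exists_bound_of_continuousOn
    (hFL.continuous.comp_continuousOn hcont)
  refine ⟨T + d, by linarith, by linarith [min_le_left e (1 / ((B : ℝ) + 1))], f, hf0, ?_, ?_⟩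
  · have hlip : LipschitzOnWith (Real.toNNReal M) f (Icc T (T + d)) := by
      refine (convex_Icc T (T + d)).lipschitzOnWith_of_nnnorm_hasDerivWithin_le hf fun s hs => ?_
      rw [← NNReal.coe_le_coe]
      exact (hM s hs).trans (Real.le_coe_toNNReal M)
    rw [← uIcc_of_le (by linarith : T ≤ T + d)] at hlip
    exact hlip.absolutelyContinuousOnInterval
  · intro s hs
    exact (hf s (Ioo_subset_Icc_self hs)).hasDerivAt (Icc_mem_nhds hs.1 hs.2)

variable [Fintype μ]

/-- Finite-time escape is impossible: on a bounded interval the solution is Lipschitz. -/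
theorem IsSolutionPair.exists_lipschitzOnWith (hS : S.IsSolutionPair φ u) (hK : 0 ≤ K)
    (hLip : ∀ x y w w', ‖S.flowMap x w - S.flowMap y w'‖ ≤ K * (‖x - y‖ + ‖w - w'‖))
    {a T : ℝ} {j : ℕ} (hsl : φ.slice j = Ico a T) :
    ∃ D : NNReal, LipschitzOnWith D (fun s => φ.val s j) (Ico a T) := by
  obtain ⟨M₀, hM₀⟩ := (hS.input j).2 T
  set M := |M₀|
  have husl : u.slice j ∩ Iic T = Ico a T := by
    have : u.slice j = φ.slice j := by simp [HybridSignal.slice, hS.dom_eq]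
    rw [this, hsl]
    exact inter_eq_left.2 fun s hs => hs.2.le
  rw [husl] at hM₀
  have hM : ∀ᵐ s ∂(volume.restrict (Ico a T)), ‖(u.val s j).first‖ ≤ M := by
    filter_upwards [hM₀] with s hs
    exact (norm_first_le _).trans (hs.trans (le_abs_self _))
  have hd := hS.flow_deriv j
  rw [hsl] at hd
  set A := ‖S.flowMap 0 0‖ + K * M with hA
  have hA0 : 0 ≤ A := by positivity
  have hbound : ∀ x w, ‖w‖ ≤ M → ‖S.flowMap x w‖ ≤ A + K * ‖x‖ := by
    intro x w hw
    refine (norm_flowMap_le hLip x w).trans ?_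
    have : K * ‖w‖ ≤ K * M := by gcongr
    rw [hA]
    linarith
  -- Chosen so that `2‖x‖(A + K‖x‖) ≤ c (1 + ‖x‖²)`. Then `e^{-cr}(1 + ‖x‖²)` is nonincreasing,
  -- which bounds `‖x‖ ≤ 1 + ‖x‖²`.
  set c := A + 2 * K with hc
  have hac : ∀ r s, a ≤ r → r ≤ s → s < T →
      AbsolutelyContinuousOnInterval (fun s => φ.val s j) r s := fun r s h1 h2 h3 =>
    hS.arc j r s h2 (hsl ▸ fun x hx => ⟨h1.trans hx.1, hx.2.trans_lt h3⟩)
  obtain ⟨R, hR, hgrow⟩ : ∃ R : ℝ, 0 ≤ R ∧ ∀ s ∈ Ico a T, ‖φ.val s j‖ ≤ R := by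
    refine ⟨Real.exp (c * (T - a)) * (1 + ‖φ.val a j‖ ^ 2), by positivity, fun s hs => ?_⟩
    have hexp : ContDiff ℝ 1 fun r : ℝ => Real.exp (-c * r) := by fun_prop
    have hsq : ContDiff ℝ 1 fun x : Vec ι => 1 + ‖x‖ ^ 2 :=
      contDiff_const.add (contDiff_id.norm_sq ℝ)
    have h1 := (ContDiffOn.absolutelyContinuousOnInterval (a := a) (b := s)
      hexp.contDiffOn).fun_mul
      (absolutelyContinuousOnInterval_comp_contDiff hsq (hac a s le_rfl hs.1 hs.2))
    have h2 := le_of_ae_hasDerivAt_nonpos hs.1 h1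
      (f' := fun r => Real.exp (-c * r) * -c * (1 + ‖φ.val r j‖ ^ 2) + Real.exp (-c * r) *
        (2 * inner ℝ (φ.val r j) (S.flowMap (φ.val r j) (u.val r j).first))) ?_
    · have h3 : 1 + ‖φ.val s j‖ ^ 2 ≤ Real.exp (c * (s - a)) * (1 + ‖φ.val a j‖ ^ 2) := by
        have h4 := mul_le_mul_of_nonneg_left h2 (Real.exp_pos (c * s)).le
        rw [← mul_assoc, ← mul_assoc, ← Real.exp_add, ← Real.exp_add] at h4
        have e1 : c * s + -c * s = 0 := by ring
        have e2 : c * s + -c * a = c * (s - a) := by ring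
        rwa [e1, e2, Real.exp_zero, one_mul] at h4
      have h4 : Real.exp (c * (s - a)) ≤ Real.exp (c * (T - a)) := by
        gcongr
        exact hs.2.le
      have h5 := mul_le_mul_of_nonneg_right h4 (by positivity : 0 ≤ 1 + ‖φ.val a j‖ ^ 2)
      nlinarith [sq_nonneg (‖φ.val s j‖ - 1), sq_nonneg (‖φ.val s j‖)]
    · have hsub : Icc a s ⊆ Ico a T := fun x hx => ⟨hx.1, hx.2.trans_lt hs.2⟩
      filter_upwards [ae_restrict_of_ae_restrict_of_subset hsub hd,
        ae_restrict_of_ae_restrict_of_subset hsub hM] with r hr hr'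
      constructor
      · have e1 : HasDerivAt (fun r : ℝ => Real.exp (-c * r)) (Real.exp (-c * r) * -c) r := by
          simpa using ((hasDerivAt_id r).const_mul (-c)).exp
        exact e1.mul (hr.norm_sq.const_add 1)
      · set x := φ.val r j
        have e2 := (real_inner_le_norm x (S.flowMap x (u.val r j).first)).trans
          (mul_le_mul_of_nonneg_left (hbound x _ hr') (norm_nonneg x))
        have e3 : 2 * inner ℝ x (S.flowMap x (u.val r j).first) ≤ c * (1 + ‖x‖ ^ 2) := by
          rw [hc]
          nlinarith [mul_nonneg hA0 (sq_nonneg (‖x‖ - 1)), sq_nonneg ‖x‖]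
        nlinarith [Real.exp_pos (-c * r), mul_le_mul_of_nonneg_left e3 (Real.exp_pos (-c * r)).le]
  refine ⟨Real.toNNReal (A + K * R), LipschitzOnWith.of_dist_le' fun x hx y hy => ?_⟩
  have key : ∀ r s, a ≤ r → r ≤ s → s < T →
      dist (φ.val s j) (φ.val r j) ≤ (A + K * R) * (s - r) := by
    intro r s h1 h2 h3
    rw [dist_eq_norm]
    refine dist_le_of_ae_hasDerivAt_norm_le (f := fun r => φ.val r j) h2 (hac r s h1 h2 h3)
      (f' := fun r => S.flowMap (φ.val r j) (u.val r j).first) ?_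
    have hsub : Icc r s ⊆ Ico a T := fun x hx => ⟨h1.trans hx.1, hx.2.trans_lt h3⟩
    filter_upwards [ae_restrict_of_ae_restrict_of_subset hsub hd,
      ae_restrict_of_ae_restrict_of_subset hsub hM, ae_restrict_mem measurableSet_Icc]
      with q hq hq' hq''
    exact ⟨hq, (hbound _ _ hq').trans (by gcongr; exact hgrow q (hsub hq''))⟩
  rcases le_total x y with hxy | hxy
  · rw [dist_comm, Real.dist_eq, abs_sub_comm, abs_of_nonneg (sub_nonneg.2 hxy)]
    exact key x y hx.1 hxy hy.2
  · rw [Real.dist_eq, abs_of_nonneg (sub_nonneg.2 hxy)]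
    exact key y x hy.1 hxy hx.2

/-- The last interval of a maximal solution pair is not bounded and open to the right. -/
theorem IsMaximalPair.false_of_Ico (hφ : S.IsMaximalPair φ u) (hK : 0 ≤ K)
    (hLip : ∀ x y w w', ‖S.flowMap x w - S.flowMap y w'‖ ≤ K * (‖x - y‖ + ‖w - w'‖))
    {t : ℕ → ℝ} (h0 : t 0 = 0) (hm : Monotone t) {J : ℕ} {T : ℝ} (hT : t J < T)
    (hdom : φ.dom = cutDomain t J (Ico (t J) T)) : False := by
  have hsl : φ.slice J = Ico (t J) T := HybridSignal.slice_eq_of_dom_eq hdom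
  have husl : u.slice J = Ico (t J) T := by
    rw [← hsl]
    simp [HybridSignal.slice, hφ.1.dom_eq]
  obtain ⟨D, hD⟩ := hφ.1.exists_lipschitzOnWith hK hLip hsl
  -- The Lipschitz extension supplies a value at the missing right end `T`.
  obtain ⟨f, hf, hfe⟩ := hD.extend_finite_dimension
  have hin := hφ.1.input J
  rw [husl] at hin
  have hae : volume.restrict (Icc (t J) T) = volume.restrict (Ico (t J) T) :=
    (Measure.restrict_congr_set Ico_ae_eq_Icc).symm
  have hIoo : volume.restrict (Icc (t J) T) = volume.restrict (Ioo (t J) T) :=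
    (Measure.restrict_congr_set Ioo_ae_eq_Icc).symm
  refine absurd (hφ.mem_last_of_flow h0 hm hdom ⟨le_rfl, hT⟩ (b := T) Ico_subset_Icc_self
    (f := f) (g := fun s => u.val s J) (fun s hs => (hfe hs).symm) (fun s _ => rfl)
    hf.lipschitzOnWith.absolutelyContinuousOnInterval (hae ▸ hin.1) ?_ ?_ ?_)
    (fun h => lt_irrefl T h.2)
  · obtain ⟨M, hM⟩ := hin.2 T
    refine ⟨M, ?_⟩
    rw [hae]
    rwa [inter_eq_left.2 (show Ico (t J) T ⊆ Iic T from fun s hs => hs.2.le)] at hM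
  · intro s hs
    rw [← hfe (Ioo_subset_Ico_self hs)]
    exact hφ.1.flow_mem J s (by rwa [hsl, interior_Ico])
  · rw [hIoo]
    have hd := hφ.1.flow_deriv J
    rw [hsl] at hd
    filter_upwards [ae_restrict_of_ae_restrict_of_subset Ioo_subset_Ico_self hd,
      ae_restrict_mem measurableSet_Ioo] with s hs hs'
    rw [← hfe (Ioo_subset_Ico_self hs')]
    refine hs.congr_of_eventuallyEq ?_
    filter_upwards [Ioo_mem_nhds hs'.1 hs'.2] with r hr
    exact (hfe (Ioo_subset_Ico_self hr)).symm

/-- The flow of a maximal solution pair cannot be continued from a closed last interval. -/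
theorem IsMaximalPair.false_of_Icc (hφ : S.IsMaximalPair φ u) {t : ℕ → ℝ} (h0 : t 0 = 0)
    (hm : Monotone t) {J : ℕ} {T b : ℝ} (hT : t J ≤ T)
    (hdom : φ.dom = cutDomain t J (Icc (t J) T)) (hb : T < b) {f : ℝ → Vec ι}
    (hfT : f T = φ.val T J) (hac : AbsolutelyContinuousOnInterval f T b)
    (hder : ∀ s ∈ Ioo T b, HasDerivAt f (S.flowMap (f s) 0) s)
    (hmem₁ : ∀ s ∈ Icc (t J) T, φ.val s J ∈ S.flowSet) (hmem₂ : ∀ s ∈ Ioo T b, f s ∈ S.flowSet) :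
    False := by
  have hsl : φ.slice J = Icc (t J) T := HybridSignal.slice_eq_of_dom_eq hdom
  have husl : u.slice J = Icc (t J) T := by
    rw [← hsl]
    simp [HybridSignal.slice, hφ.1.dom_eq]
  have hin := hφ.1.input J
  rw [husl] at hin
  have hd := hφ.1.flow_deriv J
  rw [hsl] at hd
  set F : ℝ → Vec ι := fun s => if s ≤ T then φ.val s J else f s with hF
  set g : ℝ → Vec (κ ⊕ μ) := fun s => if s ≤ T then u.val s J else 0 with hg
  have hsplit : Icc (t J) b = Icc (t J) T ∪ Ioc T b := (Icc_union_Ioc_eq_Icc hT hb.le).symm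
  refine absurd (hφ.mem_last_of_flow h0 hm hdom ⟨le_rfl, hT⟩ (b := b)
    (Icc_subset_Icc_right hb.le) (f := F) (g := g) (fun s hs => if_pos hs.2)
    (fun s hs => if_pos hs.2) ?_ ?_ ?_ ?_ ?_) (fun h => absurd h.2 (not_le.2 hb))
  · refine absolutelyContinuousOnInterval_glue hT hb.le ?_ ?_
    · refine absolutelyContinuousOnInterval_congr (hφ.1.arc J (t J) T hT hsl.ge) fun s hs => ?_
      rw [uIcc_of_le hT] at hs
      exact (if_pos hs.2).symm
    · refine absolutelyContinuousOnInterval_congr hac fun s hs => ?_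
      rw [uIcc_of_le hb.le] at hs
      rcases eq_or_lt_of_le hs.1 with rfl | h
      · simp [hF, hfT]
      · exact (if_neg (not_le.2 h)).symm
  · rw [hsplit, aemeasurable_union_iff]
    constructor
    · refine hin.1.congr ?_
      filter_upwards [ae_restrict_mem measurableSet_Icc] with s hs
      exact (if_pos hs.2).symm
    · refine (aemeasurable_const (b := (0 : Vec (κ ⊕ μ)))).congr ?_
      filter_upwards [ae_restrict_mem measurableSet_Ioc] with s hs
      exact (if_neg (not_le.2 hs.1)).symm
  · obtain ⟨M, hM⟩ := hin.2 T
    rw [inter_eq_left.2 (show Icc (t J) T ⊆ Iic T from fun s hs => hs.2)] at hM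
    refine ⟨max M 0, ?_⟩
    rw [hsplit, ae_restrict_union_iff]
    constructor
    · filter_upwards [hM, ae_restrict_mem measurableSet_Icc] with s hs hs'
      simp only [hg, if_pos hs'.2]
      exact hs.trans (le_max_left _ _)
    · filter_upwards [ae_restrict_mem measurableSet_Ioc] with s hs
      simp [hg, if_neg (not_le.2 hs.1)]
  · intro s hs
    by_cases h : s ≤ T
    · simpa only [hF, if_pos h] using hmem₁ s ⟨hs.1.le, h⟩
    · simpa only [hF, if_neg h] using hmem₂ s ⟨not_le.1 h, hs.2⟩
  · have hne : ∀ x : ℝ, ∀ᵐ s : ℝ, s ≠ x := fun x => by simp [ae_iff, measure_singleton]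
    rw [hsplit, ae_restrict_union_iff]
    constructor
    · filter_upwards [hd, ae_restrict_mem measurableSet_Icc, ae_restrict_of_ae (hne T)]
        with s hs hs' hsT
      have hlt : s < T := lt_of_le_of_ne hs'.2 hsT
      simp only [hF, hg, if_pos hs'.2]
      refine hs.congr_of_eventuallyEq ?_
      filter_upwards [Iio_mem_nhds hlt] with r hr
      exact if_pos (le_of_lt hr)
    · filter_upwards [ae_restrict_mem measurableSet_Ioc, ae_restrict_of_ae (hne b)] with s hs hsb
      have hlt : s < b := lt_of_le_of_ne hs.2 hsb
      simp only [hF, hg, if_neg (not_le.2 hs.1)]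
      refine (hder s ⟨hs.1, hlt⟩).congr_of_eventuallyEq ?_
      filter_upwards [Ioi_mem_nhds hs.1] with r hr
      exact if_neg (not_le.2 hr)

end HybridSystem

namespace Plant

variable {nz ny nw nq ns np : ℕ} {P : Plant nz ny nw nq ns np}
  {L : Matrix (Fin nz) (Fin ny) ℝ} {H : Matrix (Fin ny) (Fin ny) ℝ} {T₁ T₂ : ℝ}
  {φ : HybridSignal (Vec (StateIdx nz ny))} {u : HybridSignal (Vec (Fin nw ⊕ Fin ny))}

theorem isComplete_of_isMaximalPair {ell : ℝ} (hell : 0 < ell)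
    (hψ : ∀ v₁ v₂, ‖P.ψ v₁ - P.ψ v₂‖ ≤ ell * ‖v₁ - v₂‖) (hT₁ : 0 < T₁) (hT₂ : T₁ ≤ T₂)
    (hφ : (P.errorSystem L H T₁ T₂).IsMaximalPair φ u) : φ.IsComplete := by
  by_contra hc
  obtain ⟨K, hK, hLip⟩ := P.exists_norm_flowMap_sub_le hell hψ L H T₁ T₂
  obtain ⟨t, J, last, h0, hm, hdom, rfl | ⟨hlt, rfl⟩⟩ := φ.exists_dom_eq_cutDomain hc
  · obtain ⟨t', ht'⟩ := φ.isDomain.exists_isStartTimes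
    have htimer : ∀ s ∈ Icc (t J) (t (J + 1)), timer (φ.val s J) ∈ Icc 0 T₂ := fun s hs =>
      timer_mem hφ.1 ht' hT₁ hT₂ (by rw [hdom, mem_cutDomain_self]; exact hs)
    have hle : t J ≤ t (J + 1) := hm (Nat.le_succ J)
    obtain ⟨hτ0, hτ⟩ := htimer _ (right_mem_Icc.2 hle)
    rcases eq_or_lt_of_le hτ0 with hz | hpos
    · refine HybridSystem.not_isMaximalPair_of_jump hφ.1 h0 hm hdom hz.symm ?_ hφ
      -- The jump map is nonempty for every `η`; the timer may be reset to `T₁`.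
      exact ⟨_, T₁, ⟨le_rfl, hT₂⟩, rfl⟩
    -- The duration is limited by the remaining timer value, so the timer stays nonnegative on the
    -- continuation.
    · obtain ⟨b, hb, hbe, f, hfT, hac, hder⟩ := HybridSystem.exists_local_flow hK hLip
        (φ.val (t (J + 1)) J) (t (J + 1)) hpos
      refine hφ.false_of_Icc h0 hm hle hdom hb hfT hac hder htimer fun s hs => ?_
      have haff := eq_add_mul_of_ae_hasDerivAt_const (c := -1) hs.1.le
        (absolutelyContinuousOnInterval_comp_contDiff (timerL nz ny).contDiff
          (hac.mono (d := s) (c := t (J + 1)) (by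
            rw [uIcc_of_le hs.1.le, uIcc_of_le hb.le]
            exact Icc_subset_Icc_right hs.2.le))) ?_
      · simp only [timerL_apply, hfT] at haff
        have h1 := hs.1
        have h2 := hs.2
        change timer (f s) ∈ Icc 0 T₂
        rw [haff]
        constructor <;> linarith
      · rw [← Measure.restrict_congr_set Ioo_ae_eq_Icc]
        filter_upwards [ae_restrict_mem measurableSet_Ioo] with r hr
        exact (timerL nz ny).hasFDerivAt.comp_hasDerivAt r (hder r ⟨hr.1, hr.2.trans hs.2⟩)
  · exact hφ.false_of_Ico hK hLip h0 hm hlt hdom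

end Plant

namespace Plant

variable {nz ny nw nq ns np : ℕ} {P : Plant nz ny nw nq ns np}
  {L : Matrix (Fin nz) (Fin ny) ℝ} {H : Matrix (Fin ny) (Fin ny) ℝ} {T₁ T₂ : ℝ}
  {φ : HybridSignal (Vec (StateIdx nz ny))} {u : HybridSignal (Vec (Fin nw ⊕ Fin ny))}
  {t : ℕ → ℝ} {P₁ : Matrix (Fin nz) (Fin nz) ℝ} {P₂ : Matrix (Fin ny) (Fin ny) ℝ}
  {δ lamt γ : ℝ}

/-! ### Input-to-state stability -/

/-- Exponential decay of the storage function along a flow with bounded input. -/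
theorem storage_flow_le (hS : (P.errorSystem L H T₁ T₂).IsSolutionPair φ u)
    (ht : IsStartTimes φ.dom t) (hT₁ : 0 < T₁) (hT₂ : T₁ ≤ T₂) (hP₁ : P₁ᵀ = P₁) (hP₂ : P₂ᵀ = P₂)
    (hlamt : 0 < lamt)
    (hdiss : ∀ x w, timer x ∈ Icc 0 T₂ →
      storageDeriv P₁ P₂ δ x ((P.errorSystem L H T₁ T₂).flowMap x w) ≤
        -(2 * lamt) * storage P₁ P₂ δ x - ‖P.perfOutput x‖ ^ 2 + γ ^ 2 * ‖w‖ ^ 2)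
    {s : ℝ} {j : ℕ} (h : (s, j) ∈ φ.dom) {U : ℝ}
    (hU : ∀ᵐ r ∂(volume.restrict (φ.slice j)), ‖u.val r j‖ ≤ U) :
    storage P₁ P₂ δ (φ.val s j) - γ ^ 2 * U ^ 2 / (2 * lamt) ≤
      Real.exp (-(2 * lamt) * (s - t j)) *
        (storage P₁ P₂ δ (φ.val (t j) j) - γ ^ 2 * U ^ 2 / (2 * lamt)) := by
  have hsub := ht.Icc_subset_slice h
  have hle := ht.start_le h
  -- `k` is the equilibrium of `v̇ = -2λ_t v + γ²U²`, so `e^{2λ_t r}(V - k)` is nonincreasing.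
  set k := γ ^ 2 * U ^ 2 / (2 * lamt) with hk
  have hexp : ContDiff ℝ 1 fun r : ℝ => Real.exp (2 * lamt * r) := by fun_prop
  have hac := (ContDiffOn.absolutelyContinuousOnInterval (a := t j) (b := s)
    hexp.contDiffOn).fun_mul (absolutelyContinuousOnInterval_comp_contDiff
      ((contDiff_storage P₁ P₂ δ).sub (contDiff_const (c := k))) (hS.arc j _ _ hle hsub))
  have hmono := le_of_ae_hasDerivAt_nonpos hle hac
    (f' := fun r => Real.exp (2 * lamt * r) * (2 * lamt) * (storage P₁ P₂ δ (φ.val r j) - k) +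
      Real.exp (2 * lamt * r) * storageDeriv P₁ P₂ δ (φ.val r j)
        ((P.errorSystem L H T₁ T₂).flowMap (φ.val r j) (u.val r j).first)) ?_
  · have h1 := mul_le_mul_of_nonneg_left hmono (Real.exp_pos (-(2 * lamt) * s)).le
    rw [← mul_assoc, ← mul_assoc, ← Real.exp_add, ← Real.exp_add] at h1
    have e1 : -(2 * lamt) * s + 2 * lamt * s = 0 := by ring
    have e2 : -(2 * lamt) * s + 2 * lamt * t j = -(2 * lamt) * (s - t j) := by ring
    rwa [e1, e2, Real.exp_zero, one_mul] at h1
  · filter_upwards [ae_restrict_of_ae_restrict_of_subset hsub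
      (ae_hasDerivAt_storage hS hP₁ hP₂ δ j), ae_restrict_of_ae_restrict_of_subset hsub hU,
      ae_restrict_mem measurableSet_Icc] with r hr hrU hr'
    constructor
    · have e1 : HasDerivAt (fun r : ℝ => Real.exp (2 * lamt * r))
          (Real.exp (2 * lamt * r) * (2 * lamt)) r := by
        simpa using ((hasDerivAt_id r).const_mul (2 * lamt)).exp
      exact e1.mul (hr.sub_const k)
    · have hd := hdiss (φ.val r j) (u.val r j).first (timer_mem hS ht hT₁ hT₂ (hsub hr'))
      have hw : γ ^ 2 * ‖(u.val r j).first‖ ^ 2 ≤ γ ^ 2 * U ^ 2 := by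
        gcongr
        exact (norm_first_le _).trans hrU
      have hk' : 2 * lamt * k = γ ^ 2 * U ^ 2 := by
        rw [hk]
        field_simp
      have hsum : 2 * lamt * (storage P₁ P₂ δ (φ.val r j) - k) + storageDeriv P₁ P₂ δ (φ.val r j)
          ((P.errorSystem L H T₁ T₂).flowMap (φ.val r j) (u.val r j).first) ≤ 0 := by
        nlinarith [sq_nonneg ‖P.perfOutput (φ.val r j)‖]
      nlinarith [mul_le_mul_of_nonneg_left hsum (Real.exp_pos (2 * lamt * r)).le]

/-- Bounds at the start of a flow interval propagate along the interval. -/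
theorem storage_le_of_start_le (hS : (P.errorSystem L H T₁ T₂).IsSolutionPair φ u)
    (ht : IsStartTimes φ.dom t) (hT₁ : 0 < T₁) (hT₂ : T₁ ≤ T₂) (hP₁ : P₁ᵀ = P₁) (hP₂ : P₂ᵀ = P₂)
    (hlamt : 0 < lamt)
    (hdiss : ∀ x w, timer x ∈ Icc 0 T₂ →
      storageDeriv P₁ P₂ δ x ((P.errorSystem L H T₁ T₂).flowMap x w) ≤
        -(2 * lamt) * storage P₁ P₂ δ x - ‖P.perfOutput x‖ ^ 2 + γ ^ 2 * ‖w‖ ^ 2)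
    {U : ℝ} {s : ℝ} {j : ℕ} (h : (s, j) ∈ φ.dom)
    (hU : ∀ᵐ r ∂(volume.restrict (φ.slice j)), ‖u.val r j‖ ≤ U) {v d : ℝ}
    (hd : storage P₁ P₂ δ (φ.val (t j) j) ≤
      Real.exp (-(2 * lamt) * t j) * v + γ ^ 2 * U ^ 2 / (2 * lamt) + d) :
    storage P₁ P₂ δ (φ.val s j) ≤ Real.exp (-(2 * lamt) * s) * v +
      γ ^ 2 * U ^ 2 / (2 * lamt) + Real.exp (-(2 * lamt) * (s - t j)) * d := by
  have h1 := storage_flow_le hS ht hT₁ hT₂ hP₁ hP₂ hlamt hdiss h hU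
  have h2 := mul_le_mul_of_nonneg_left (sub_le_iff_le_add.2 (hd.trans_eq (add_right_comm _ _ _)))
    (Real.exp_pos (-(2 * lamt) * (s - t j))).le
  have h3 : Real.exp (-(2 * lamt) * (s - t j)) * Real.exp (-(2 * lamt) * t j) =
      Real.exp (-(2 * lamt) * s) := by
    rw [← Real.exp_add]
    congr 1
    ring
  rw [mul_add, ← mul_assoc, h3] at h2
  linarith

/-- Bound on the storage function at the start of the flow intervals, for `c ≥ a c + q` with the
contraction factor `a` of a full interval and the jump gain `q`. -/
theorem storage_start_le (hS : (P.errorSystem L H T₁ T₂).IsSolutionPair φ u)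
    (hu : u.linfty < ⊤) (ht : IsStartTimes φ.dom t) (hT₁ : 0 < T₁) (hT₂ : T₁ ≤ T₂)
    (hP₁ : P₁ᵀ = P₁) (hP₂ : P₂.PosDef) (hδ : 0 < δ) (hlamt : 0 < lamt)
    (hdiss : ∀ x w, timer x ∈ Icc 0 T₂ →
      storageDeriv P₁ P₂ δ x ((P.errorSystem L H T₁ T₂).flowMap x w) ≤
        -(2 * lamt) * storage P₁ P₂ δ x - ‖P.perfOutput x‖ ^ 2 + γ ^ 2 * ‖w‖ ^ 2)
    {c : ℝ} (hc : 0 ≤ c)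
    (hac : Real.exp (-(2 * lamt) * T₁) * c + Real.exp (δ * T₂) * ‖mulVL P₂‖ ≤ c) {j : ℕ}
    (hj : (t j, j) ∈ φ.dom) :
    storage P₁ P₂ δ (φ.val (t j) j) ≤
      Real.exp (-(2 * lamt) * t j) * storage P₁ P₂ δ (φ.val 0 0) +
        γ ^ 2 * u.linfty.toReal ^ 2 / (2 * lamt) +
        (if j = 0 then 0 else c * u.linfty.toReal ^ 2) := by
  have hP₂' : P₂ᵀ = P₂ := hP₂.isHermitian
  set q := Real.exp (δ * T₂) * ‖mulVL P₂‖
  set U := u.linfty.toReal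
  induction j with
  | zero =>
    have : 0 ≤ γ ^ 2 * U ^ 2 / (2 * lamt) := by positivity
    simpa [ht.zero] using this
  | succ j ih =>
    have h1 := ht.end_mem hj
    have h2 := storage_le_of_start_le hS ht hT₁ hT₂ hP₁ hP₂' hlamt hdiss h1
      (HybridSignal.ae_norm_le_linfty ht hS.dom_eq hu j) (ih (ht.start_mem h1))
    have h3 := storage_jump_le (P₁ := P₁) hS ht hP₂ hδ hj
    have h4 : ‖(u.val (t (j + 1)) j).second‖ ≤ U := by
      have hmem : (t (j + 1), j) ∈ u.jumpSet := by
        rw [HybridSignal.jumpSet, ← hS.dom_eq]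
        exact ⟨h1, hj⟩
      have hle : ‖u.val (t (j + 1)) j‖ ≤ U := HybridSignal.norm_le_linfty_of_mem_jumpSet hu hmem
      exact (norm_second_le (u.val (t (j + 1)) j)).trans hle
    have h5 : q * ‖(u.val (t (j + 1)) j).second‖ ^ 2 ≤ q * U ^ 2 := by gcongr
    -- The first interval may be too short to contract, but no jump contribution is present there.
    -- On later intervals the spacing `T₁` gives the contraction factor.
    have h6 : Real.exp (-(2 * lamt) * (t (j + 1) - t j)) *
        (if j = 0 then 0 else c * U ^ 2) + q * U ^ 2 ≤ c * U ^ 2 := by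
      have h7 : (Real.exp (-(2 * lamt) * T₁) * c + q) * U ^ 2 ≤ c * U ^ 2 := by gcongr
      have h8 : 0 ≤ Real.exp (-(2 * lamt) * T₁) * c * U ^ 2 := by positivity
      rcases j with _ | j
      · rw [if_pos rfl]
        linarith
      · rw [if_neg (Nat.succ_ne_zero j)]
        have h9 : Real.exp (-(2 * lamt) * (t (j + 1 + 1) - t (j + 1))) ≤
            Real.exp (-(2 * lamt) * T₁) := by
          apply Real.exp_le_exp.2
          nlinarith [start_spacing hS ht hj]
        have h10 := mul_le_mul_of_nonneg_right h9 (by positivity : 0 ≤ c * U ^ 2)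
        linarith
    rw [if_neg (Nat.succ_ne_zero j)]
    linarith

theorem exists_storage_le (hT₁ : 0 < T₁) (hT₂ : T₁ ≤ T₂) (hP₁ : P₁ᵀ = P₁) (hP₂ : P₂.PosDef)
    (hδ : 0 < δ) (hlamt : 0 < lamt)
    (hdiss : ∀ x w, timer x ∈ Icc 0 T₂ →
      storageDeriv P₁ P₂ δ x ((P.errorSystem L H T₁ T₂).flowMap x w) ≤
        -(2 * lamt) * storage P₁ P₂ δ x - ‖P.perfOutput x‖ ^ 2 + γ ^ 2 * ‖w‖ ^ 2) :
    ∃ Γ ≥ (0 : ℝ), ∀ φ u, (P.errorSystem L H T₁ T₂).IsSolutionPair φ u → u.linfty < ⊤ →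
      ∀ s j, (s, j) ∈ φ.dom → storage P₁ P₂ δ (φ.val s j) ≤
        Real.exp (-(2 * lamt) * s) * storage P₁ P₂ δ (φ.val 0 0) + Γ * u.linfty.toReal ^ 2 := by
  have hP₂' : P₂ᵀ = P₂ := hP₂.isHermitian
  have ha1 : Real.exp (-(2 * lamt) * T₁) < 1 := Real.exp_lt_one_iff.2 (by nlinarith)
  obtain ⟨c, hc, hac⟩ : ∃ c : ℝ, 0 ≤ c ∧
      Real.exp (-(2 * lamt) * T₁) * c + Real.exp (δ * T₂) * ‖mulVL P₂‖ ≤ c := by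
    have h1 : 0 < 1 - Real.exp (-(2 * lamt) * T₁) := by linarith
    -- The fixed point of `c ↦ a c + q`, that is, the sum `q / (1 - a)` of the geometric series of
    -- jump contributions.
    refine ⟨Real.exp (δ * T₂) * ‖mulVL P₂‖ / (1 - Real.exp (-(2 * lamt) * T₁)), by positivity, ?_⟩
    have h2 := div_mul_cancel₀ (Real.exp (δ * T₂) * ‖mulVL P₂‖) h1.ne'
    linarith
  refine ⟨γ ^ 2 / (2 * lamt) + c, by positivity, fun φ u hS hu s j hsj => ?_⟩
  obtain ⟨t, ht⟩ := φ.isDomain.exists_isStartTimes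
  have h1 := storage_le_of_start_le hS ht hT₁ hT₂ hP₁ hP₂' hlamt hdiss hsj
    (HybridSignal.ae_norm_le_linfty ht hS.dom_eq hu j)
    (storage_start_le hS hu ht hT₁ hT₂ hP₁ hP₂ hδ hlamt hdiss hc hac (ht.start_mem hsj))
  have h2 : Real.exp (-(2 * lamt) * (s - t j)) * (if j = 0 then 0 else c * u.linfty.toReal ^ 2) ≤
      c * u.linfty.toReal ^ 2 := by
    have e1 : Real.exp (-(2 * lamt) * (s - t j)) ≤ 1 := by
      apply Real.exp_le_one_iff.2
      nlinarith [ht.start_le hsj]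
    have e2 : 0 ≤ c * u.linfty.toReal ^ 2 := by positivity
    split_ifs
    · simpa using e2
    · exact mul_le_of_le_one_left e2 e1
  have h3 : (γ ^ 2 / (2 * lamt) + c) * u.linfty.toReal ^ 2 =
      γ ^ 2 * u.linfty.toReal ^ 2 / (2 * lamt) + c * u.linfty.toReal ^ 2 := by ring
  rw [h3]
  linarith

theorem isPreEISS (hT₁ : 0 < T₁) (hT₂ : T₁ ≤ T₂) (hP₁ : P₁.PosDef) (hP₂ : P₂.PosDef)
    (hδ : 0 < δ) (hlamt : 0 < lamt)
    (hdiss : ∀ x w, timer x ∈ Icc 0 T₂ →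
      storageDeriv P₁ P₂ δ x ((P.errorSystem L H T₁ T₂).flowMap x w) ≤
        -(2 * lamt) * storage P₁ P₂ δ x - ‖P.perfOutput x‖ ^ 2 + γ ^ 2 * ‖w‖ ^ 2) :
    (P.errorSystem L H T₁ T₂).IsPreEISS (attractor nz ny T₂) := by
  obtain ⟨c₁, hc₁, c₂, hc₂, hc⟩ := exists_storage_bounds hP₁ hP₂ hδ T₂
  obtain ⟨Γ, hΓ, hst⟩ := exists_storage_le (P₁ := P₁) hT₁ hT₂ hP₁.isHermitian hP₂ hδ hlamt hdiss
  -- From `T₁ j ≤ s + T₁` this rate satisfies `lam (s + j) ≤ lamt s + lam`; the excess `lam` becomes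
  -- the factor `e^{lam}` of the overshoot constant.
  set lam := lamt * T₁ / (1 + T₁) with hlam
  have hlam0 : 0 < lam := by positivity
  -- The factors `2` come from bounding a sum by twice its maximum. The added `1` makes `ρ` strictly
  -- increasing even if `Γ = 0`.
  refine ⟨√(2 * c₂ / c₁) * Real.exp lam, by positivity, lam, hlam0,
    fun r => (√(2 * Γ / c₁) + 1) * r, ⟨by fun_prop, ?_, by simp⟩, fun φ u hS hu s j hsj => ?_⟩
  · intro x _ y _ hxy
    have : 0 < √(2 * Γ / c₁) + 1 := by positivity
    exact mul_lt_mul_of_pos_left hxy this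
  obtain ⟨t, ht⟩ := φ.isDomain.exists_isStartTimes
  have hτ := timer_mem hS ht hT₁ hT₂ hsj
  have hτ0 := timer_mem hS ht hT₁ hT₂ ht.zero_mem
  rw [infDist_attractor hτ, infDist_attractor hτ0]
  have h := hst φ u hS hu s j hsj
  set U := u.linfty.toReal
  have hU : 0 ≤ U := ENNReal.toReal_nonneg
  set e := ‖errPart (φ.val s j)‖
  set e₀ := ‖errPart (φ.val 0 0)‖
  have h1 : c₁ * e ^ 2 ≤ Real.exp (-(2 * lamt) * s) * (c₂ * e₀ ^ 2) + Γ * U ^ 2 := by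
    have := mul_le_mul_of_nonneg_left (hc _ hτ0).2 (Real.exp_pos (-(2 * lamt) * s)).le
    linarith [(hc _ hτ).1]
  have hexp : Real.exp (-lamt * s) ≤ Real.exp lam * Real.exp (-lam * (s + j)) := by
    rw [← Real.exp_add]
    apply Real.exp_le_exp.2
    have h2 := mul_index_le hT₁ hS ht hsj
    have h3 : lam * (1 + T₁) = lamt * T₁ := by
      rw [hlam]
      field_simp
    have h4 : lam * (T₁ * (s + j)) ≤ lam * ((1 + T₁) * s + T₁) := by
      gcongr
      linarith
    have h5 : T₁ * (lam * (s + j)) ≤ T₁ * (lamt * s + lam) := by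
      have : T₁ * (lamt * s + lam) = lam * ((1 + T₁) * s + T₁) := by linear_combination (-s) * h3
      rw [this]
      linarith
    have := le_of_mul_le_mul_left h5 hT₁
    linarith
  have hsq : Real.exp (-(2 * lamt) * s) = Real.exp (-lamt * s) ^ 2 := by
    rw [← Real.exp_nat_mul]
    congr 1
    push_cast
    ring
  rcases le_total (Γ * U ^ 2) (Real.exp (-(2 * lamt) * s) * (c₂ * e₀ ^ 2)) with hcase | hcase
  · refine le_max_of_le_left ?_
    have h2 : e ^ 2 ≤ (√(2 * c₂ / c₁) * Real.exp (-lamt * s) * e₀) ^ 2 := by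
      rw [mul_pow, mul_pow, Real.sq_sqrt (by positivity), ← hsq]
      have : 2 * c₂ / c₁ * Real.exp (-(2 * lamt) * s) * e₀ ^ 2 =
          2 * (Real.exp (-(2 * lamt) * s) * (c₂ * e₀ ^ 2)) / c₁ := by ring
      rw [this, le_div_iff₀ hc₁]
      linarith
    refine (le_of_sq_le_sq h2 (by positivity)).trans ?_
    rw [mul_assoc (√(2 * c₂ / c₁)) (Real.exp lam)]
    gcongr
  · refine le_max_of_le_right ?_
    have h2 : e ^ 2 ≤ (√(2 * Γ / c₁) * U) ^ 2 := by
      rw [mul_pow, Real.sq_sqrt (by positivity)]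
      have : 2 * Γ / c₁ * U ^ 2 = 2 * (Γ * U ^ 2) / c₁ := by ring
      rw [this, le_div_iff₀ hc₁]
      linarith
    refine (le_of_sq_le_sq h2 (by positivity)).trans ?_
    simp only
    linarith

/-! ### The `L₂` gain -/

/-- The integrated dissipation inequality without its decay term. The storage at the end is kept on
the left so that the estimates telescope across jumps. -/
theorem lintegral_flow_Icc_le (hS : (P.errorSystem L H T₁ T₂).IsSolutionPair φ u)
    (ht : IsStartTimes φ.dom t) (hT₁ : 0 < T₁) (hT₂ : T₁ ≤ T₂) (hP₁ : P₁.PosDef) (hP₂ : P₂.PosDef)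
    (hδ : 0 < δ) (hlamt : 0 < lamt)
    (hdiss : ∀ x w, timer x ∈ Icc 0 T₂ →
      storageDeriv P₁ P₂ δ x ((P.errorSystem L H T₁ T₂).flowMap x w) ≤
        -(2 * lamt) * storage P₁ P₂ δ x - ‖P.perfOutput x‖ ^ 2 + γ ^ 2 * ‖w‖ ^ 2)
    {s : ℝ} {j : ℕ} (h : (s, j) ∈ φ.dom) :
    (∫⁻ r in Icc (t j) s, ‖P.perfOutput (φ.val r j)‖ₑ ^ 2) +
        ENNReal.ofReal (storage P₁ P₂ δ (φ.val s j)) ≤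
      ENNReal.ofReal (storage P₁ P₂ δ (φ.val (t j) j)) +
        ENNReal.ofReal (γ ^ 2) * ∫⁻ r in Icc (t j) s, ‖(u.val r j).first‖ₑ ^ 2 := by
  have hsub := ht.Icc_subset_slice h
  have hle := ht.start_le h
  have hpos : ∀ r ∈ Icc (t j) s, 0 ≤ storage P₁ P₂ δ (φ.val r j) := by
    obtain ⟨c₁, hc₁, c₂, hc₂, hc⟩ := exists_storage_bounds hP₁ hP₂ hδ T₂
    intro r hr
    exact le_trans (by positivity) (hc _ (timer_mem hS ht hT₁ hT₂ (hsub hr))).1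
  have hy : IntegrableOn (fun r => ‖P.perfOutput (φ.val r j)‖ ^ 2) (Icc (t j) s) := by
    have hc := (hS.arc j _ _ hle hsub).continuousOn
    rw [uIcc_of_le hle] at hc
    refine ContinuousOn.integrableOn_Icc ?_
    exact (((mulVL P.Cp).comp (epsL nz ny)).continuous.comp_continuousOn hc).norm.pow 2
  have huslice : Icc (t j) s ⊆ u.slice j := fun r hr => by
    have : (r, j) ∈ φ.dom := hsub hr
    rwa [hS.dom_eq] at this
  have hw : IntegrableOn (fun r => ‖(u.val r j).first‖ ^ 2) (Icc (t j) s) := by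
    obtain ⟨M, hM⟩ := (hS.input j).2 s
    have hM' := ae_restrict_of_ae_restrict_of_subset
      (subset_inter huslice (fun r (hr : r ∈ Icc (t j) s) => hr.2)) hM
    have hm := (hS.input j).1.mono_measure (Measure.restrict_mono huslice le_rfl)
    have hm' : AEMeasurable (fun r => (u.val r j).first) (volume.restrict (Icc (t j) s)) :=
      (firstL (Fin nw) (Fin ny)).continuous.measurable.comp_aemeasurable hm
    refine Integrable.of_bound (hm'.norm.pow_const 2).aestronglyMeasurable (M ^ 2) ?_
    filter_upwards [hM'] with r hr
    rw [norm_pow, norm_norm]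
    gcongr
    exact (norm_first_le _).trans hr
  have hmain := sub_le_integral_of_ae_hasDerivAt_le hle
    (absolutelyContinuousOnInterval_comp_contDiff (contDiff_storage P₁ P₂ δ)
      (hS.arc j _ _ hle hsub))
    (f' := fun r => storageDeriv P₁ P₂ δ (φ.val r j)
      ((P.errorSystem L H T₁ T₂).flowMap (φ.val r j) (u.val r j).first))
    (h := fun r => γ ^ 2 * ‖(u.val r j).first‖ ^ 2 - ‖P.perfOutput (φ.val r j)‖ ^ 2) ?_
    ((hw.const_mul (γ ^ 2)).sub' hy)
  · rw [integral_sub (hw.const_mul _) hy, integral_const_mul] at hmain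
    have e : ∀ {E : Type} [NormedAddCommGroup E] (v : E), ‖v‖ₑ ^ 2 = ENNReal.ofReal (‖v‖ ^ 2) := by
      intro E _ v
      rw [ENNReal.ofReal_pow (norm_nonneg v), ofReal_norm]
    simp only [e]
    rw [← ofReal_integral_eq_lintegral_ofReal hy (ae_of_all _ fun _ => sq_nonneg _),
      ← ofReal_integral_eq_lintegral_ofReal hw (ae_of_all _ fun _ => sq_nonneg _),
      ← ENNReal.ofReal_mul (sq_nonneg γ),
      ← ENNReal.ofReal_add (integral_nonneg fun _ => sq_nonneg _) (hpos s ⟨hle, le_rfl⟩),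
      ← ENNReal.ofReal_add (hpos (t j) ⟨le_rfl, hle⟩)
        (mul_nonneg (sq_nonneg γ) (integral_nonneg fun _ => sq_nonneg _))]
    exact ENNReal.ofReal_le_ofReal (by linarith)
  · filter_upwards [ae_restrict_of_ae_restrict_of_subset hsub
      (ae_hasDerivAt_storage hS hP₁.isHermitian hP₂.isHermitian δ j),
      ae_restrict_mem measurableSet_Icc] with r hr hr'
    refine ⟨hr, ?_⟩
    have h1 := hdiss (φ.val r j) (u.val r j).first (timer_mem hS ht hT₁ hT₂ (hsub hr'))
    have h2 : 0 ≤ 2 * lamt * storage P₁ P₂ δ (φ.val r j) :=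
      mul_nonneg (by positivity) (hpos r hr')
    linarith

theorem sum_lintegral_slice_le (hS : (P.errorSystem L H T₁ T₂).IsSolutionPair φ u)
    (ht : IsStartTimes φ.dom t) (hT₁ : 0 < T₁) (hT₂ : T₁ ≤ T₂) (hP₁ : P₁.PosDef) (hP₂ : P₂.PosDef)
    (hδ : 0 < δ) (hlamt : 0 < lamt)
    (hdiss : ∀ x w, timer x ∈ Icc 0 T₂ →
      storageDeriv P₁ P₂ δ x ((P.errorSystem L H T₁ T₂).flowMap x w) ≤
        -(2 * lamt) * storage P₁ P₂ δ x - ‖P.perfOutput x‖ ^ 2 + γ ^ 2 * ‖w‖ ^ 2)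
    (hη : ∀ t j, (t, j) ∈ u.dom → (u.val t j).second = 0) (n : ℕ) :
    ∑ j ∈ Finset.range n, (∫⁻ r in φ.slice j, ‖P.perfOutput (φ.val r j)‖ₑ ^ 2) ≤
      ENNReal.ofReal (storage P₁ P₂ δ (φ.val 0 0)) + ENNReal.ofReal (γ ^ 2) *
        ∑ j ∈ Finset.range n, ∫⁻ r in φ.slice j, ‖(u.val r j).first‖ₑ ^ 2 := by
  have hIcc : ∀ {s j}, (s, j) ∈ φ.dom → _ := fun {s j} (h : (s, j) ∈ φ.dom) =>
    lintegral_flow_Icc_le hS ht hT₁ hT₂ hP₁ hP₂ hδ hlamt hdiss h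
  -- Two claims are carried: the one with the storage at `t n` drives the induction but makes sense
  -- only while interval `n` exists. The last interval may have no right end, so the plain bound is
  -- needed there.
  have key : (∑ j ∈ Finset.range n, ∫⁻ r in φ.slice j, ‖P.perfOutput (φ.val r j)‖ₑ ^ 2) ≤
        ENNReal.ofReal (storage P₁ P₂ δ (φ.val 0 0)) + ENNReal.ofReal (γ ^ 2) *
        (∑ j ∈ Finset.range n, ∫⁻ r in φ.slice j, ‖(u.val r j).first‖ₑ ^ 2) ∧
      ((t n, n) ∈ φ.dom →
        (∑ j ∈ Finset.range n, ∫⁻ r in φ.slice j, ‖P.perfOutput (φ.val r j)‖ₑ ^ 2) +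
          ENNReal.ofReal (storage P₁ P₂ δ (φ.val (t n) n)) ≤
        ENNReal.ofReal (storage P₁ P₂ δ (φ.val 0 0)) + ENNReal.ofReal (γ ^ 2) *
          ∑ j ∈ Finset.range n, ∫⁻ r in φ.slice j, ‖(u.val r j).first‖ₑ ^ 2) := by
    induction n with
    | zero => simp [ht.zero]
    | succ n ih =>
      rw [Finset.sum_range_succ, Finset.sum_range_succ, mul_add]
      by_cases hn : (t n, n) ∈ φ.dom
      · have h1 := ih.2 hn
        constructor
        · have h2 : ∫⁻ r in φ.slice n, ‖P.perfOutput (φ.val r n)‖ₑ ^ 2 ≤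
              ENNReal.ofReal (storage P₁ P₂ δ (φ.val (t n) n)) + ENNReal.ofReal (γ ^ 2) *
                ∫⁻ r in φ.slice n, ‖(u.val r n).first‖ₑ ^ 2 := by
            refine ht.lintegral_slice_le fun s hs => (le_self_add.trans (hIcc hs)).trans ?_
            gcongr
            exact ht.Icc_subset_slice hs
          refine (add_le_add_right h2 _).trans ?_
          rw [← add_assoc, ← add_assoc]
          exact add_le_add_left h1 _
        · intro hn'
          have h2 := hIcc (ht.end_mem hn')
          have hslice : φ.slice n = Icc (t n) (t (n + 1)) :=
            Subset.antisymm (fun s hs => ⟨ht.start_le hs, ht.le_end hs hn'⟩)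
              (ht.Icc_subset_slice (ht.end_mem hn'))
          have h3 := storage_jump_le (P₁ := P₁) hS ht hP₂ hδ hn'
          rw [hη _ _ (hS.dom_eq ▸ ht.end_mem hn'), norm_zero] at h3
          have h4 : ENNReal.ofReal (storage P₁ P₂ δ (φ.val (t (n + 1)) (n + 1))) ≤
              ENNReal.ofReal (storage P₁ P₂ δ (φ.val (t (n + 1)) n)) :=
            ENNReal.ofReal_le_ofReal (by simpa using h3)
          rw [hslice, add_assoc]
          refine (add_le_add_right ((add_le_add_right h4 _).trans h2) _).trans ?_
          rw [← add_assoc, ← add_assoc]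
          exact add_le_add_left h1 _
      · have hempty : φ.slice n = ∅ :=
          eq_empty_of_forall_notMem fun s hs => hn (ht.start_mem hs)
        have hn' : (t (n + 1), n + 1) ∉ φ.dom := fun h => hn (ht.start_mem (ht.end_mem h))
        simpa [hempty, hn'] using ih.1
  exact key.1

theorem hasL2Gain (hT₁ : 0 < T₁) (hT₂ : T₁ ≤ T₂) (hP₁ : P₁.PosDef) (hP₂ : P₂.PosDef)
    (hδ : 0 < δ) (hlamt : 0 < lamt) (hγ : 0 < γ)
    (hdiss : ∀ x w, timer x ∈ Icc 0 T₂ →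
      storageDeriv P₁ P₂ δ x ((P.errorSystem L H T₁ T₂).flowMap x w) ≤
        -(2 * lamt) * storage P₁ P₂ δ x - ‖P.perfOutput x‖ ^ 2 + γ ^ 2 * ‖w‖ ^ 2) :
    P.HasL2Gain L H T₁ T₂ γ := by
  obtain ⟨c₁, hc₁, c₂, hc₂, hc⟩ := exists_storage_bounds hP₁ hP₂ hδ T₂
  -- The initial storage is at most `c₂ |φ(0,0)|_𝓐²`, whose root gives `α = √c₂`.
  refine ⟨√c₂, by positivity, fun φ u hS hη => ?_⟩
  obtain ⟨t, ht⟩ := φ.isDomain.exists_isStartTimes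
  have hτ0 := timer_mem hS ht hT₁ hT₂ ht.zero_mem
  rw [infDist_attractor hτ0]
  set e₀ := ‖errPart (φ.val 0 0)‖
  have hidx : ∀ s, u.firstIdx s = φ.firstIdx s := fun s => by
    simp [HybridSignal.firstIdx, hS.dom_eq]
  have hslice : ∀ (j : ℕ) (f : ℕ → ℝ → ℝ≥0∞), ∫⁻ s in φ.slice j, f (φ.firstIdx s) s =
      ∫⁻ s in φ.slice j, f j s := by
    intro j f
    rw [← Measure.restrict_congr_set (ht.interior_slice_ae_eq j)]
    refine setLIntegral_congr_fun isOpen_interior.measurableSet fun s hs => ?_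
    simp only [ht.firstIdx_eq hs]
  have hY : ∫⁻ s in φ.domT, ‖P.perfOutput (φ.val s (φ.firstIdx s))‖ₑ ^ 2 ≤
      ∑' j, ∫⁻ s in φ.slice j, ‖P.perfOutput (φ.val s j)‖ₑ ^ 2 := by
    have hdomT : φ.domT = ⋃ j, φ.slice j := by
      ext s
      simp [HybridSignal.domT, HybridSignal.slice]
    rw [hdomT]
    refine (lintegral_iUnion_le _ _).trans_eq (tsum_congr fun j => ?_)
    exact hslice j fun j s => ‖P.perfOutput (φ.val s j)‖ₑ ^ 2
  -- For the output, countable subadditivity over the slices was enough. Here the sum must be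
  -- bounded by the integral, which requires the disjoint interiors.
  have hW : ∀ n, ∑ j ∈ Finset.range n, ∫⁻ s in φ.slice j, ‖(u.val s j).first‖ₑ ^ 2 ≤
      ∫⁻ s in u.domT, ‖(u.val s (u.firstIdx s)).first‖ₑ ^ 2 := by
    intro n
    refine (ENNReal.sum_le_tsum _).trans ?_
    have h1 : ∀ j, ∫⁻ s in φ.slice j, ‖(u.val s j).first‖ₑ ^ 2 =
        ∫⁻ s in interior (φ.slice j), ‖(u.val s (u.firstIdx s)).first‖ₑ ^ 2 := by
      intro j
      rw [Measure.restrict_congr_set (ht.interior_slice_ae_eq j)]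
      simp only [hidx]
      exact (hslice j fun j s => ‖(u.val s j).first‖ₑ ^ 2).symm
    simp only [h1]
    rw [← lintegral_iUnion (fun j => isOpen_interior.measurableSet) ht.disjoint_interior_slice]
    refine lintegral_mono_set (iUnion_subset fun j s hs => ⟨j, ?_⟩)
    have : (s, j) ∈ φ.dom := (interior_subset hs : s ∈ φ.slice j)
    exact hS.dom_eq ▸ this
  set W := ∫⁻ s in u.domT, ‖(u.val s (u.firstIdx s)).first‖ₑ ^ 2
  have hmain : ∫⁻ s in φ.domT, ‖P.perfOutput (φ.val s (φ.firstIdx s))‖ₑ ^ 2 ≤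
      ENNReal.ofReal ((√c₂ * e₀) ^ 2) + ENNReal.ofReal (γ ^ 2) * W := by
    refine hY.trans (ENNReal.tsum_le_of_sum_range_le fun n => ?_)
    refine (sum_lintegral_slice_le hS ht hT₁ hT₂ hP₁ hP₂ hδ hlamt hdiss hη n).trans ?_
    gcongr
    · rw [mul_pow, Real.sq_sqrt hc₂.le]
      exact (hc _ hτ0).2
    · exact hW n
  have hsqrt : ∀ x : ℝ, 0 ≤ x → ENNReal.ofReal (x ^ 2) ^ (1 / 2 : ℝ) = ENNReal.ofReal x := by
    intro x hx
    rw [ENNReal.ofReal_rpow_of_nonneg (sq_nonneg x) (by norm_num), ← Real.sqrt_eq_rpow,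
      Real.sqrt_sq hx]
  calc _ ≤ (ENNReal.ofReal ((√c₂ * e₀) ^ 2) + ENNReal.ofReal (γ ^ 2) * W) ^ (1 / 2 : ℝ) := by
        gcongr
    -- Subadditivity of the square root separates the initial error from the disturbance.
    _ ≤ ENNReal.ofReal ((√c₂ * e₀) ^ 2) ^ (1 / 2 : ℝ) +
        (ENNReal.ofReal (γ ^ 2) * W) ^ (1 / 2 : ℝ) :=
      ENNReal.rpow_add_le_add_rpow _ _ (by norm_num) (by norm_num)
    _ = _ := by
      rw [ENNReal.mul_rpow_of_nonneg _ _ (by norm_num), hsqrt _ (by positivity), hsqrt _ hγ.le]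

end Plant

end SporadicObs

/-! ### Stability, completeness and gain from one dissipation inequality -/

theorem corollary1 {nz ny nw nq ns np : ℕ} (P : SporadicObs.Plant nz ny nw nq ns np)
    (ell : ℝ) (hell : 0 < ell) (hψ : ∀ v₁ v₂, ‖P.ψ v₁ - P.ψ v₂‖ ≤ ell * ‖v₁ - v₂‖)
    (T₁ T₂ : ℝ) (hT₁ : 0 < T₁) (hT₂ : T₁ ≤ T₂)
    (lamt : ℝ) (hlamt : 0 < lamt)
    (P₁ : Matrix (Fin nz) (Fin nz) ℝ) (hP₁ : P₁.PosDef)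
    (P₂ : Matrix (Fin ny) (Fin ny) ℝ) (hP₂ : P₂.PosDef)
    (δ χ : ℝ) (hδ : 0 < δ) (hχ : 0 < χ)
    (L : Matrix (Fin nz) (Fin ny) ℝ) (H : Matrix (Fin ny) (Fin ny) ℝ)
    (hM₀ : (-P.calMred lamt ell P₁ P₂ δ χ L H 0).PosDef)
    (hMT : (-P.calMred lamt ell P₁ P₂ δ χ L H T₂).PosDef) :
    ∃ γ > (0 : ℝ),
      (P.errorSystem L H T₁ T₂).IsEISS (SporadicObs.Plant.attractor nz ny T₂) ∧
        P.HasL2Gain L H T₁ T₂ γ := by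
  obtain ⟨γ, hγ, hdiss⟩ :=
    P.exists_storageDeriv_le hψ hP₁.isHermitian hP₂.isHermitian hδ hχ T₁ hM₀ hMT
  exact ⟨γ, hγ, ⟨SporadicObs.Plant.isPreEISS hT₁ hT₂ hP₁ hP₂ hδ hlamt hdiss,
    fun φ u h => SporadicObs.Plant.isComplete_of_isMaximalPair hell hψ hT₁ hT₂ h⟩,
    SporadicObs.Plant.hasL2Gain hT₁ hT₂ hP₁ hP₂ hδ hlamt hγ hdiss⟩
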